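/- **Setting.** Let $\mathbf X_n=(X_1,\dots,X_n)$ be data, let $\Theta$ be a parameter space with a ($\sigma$-finite) prior $\Pi$, and let $L:\Theta\to\mathbb R$ be a population objective function whose identified set $\Theta_I=\arg\max_\Theta L$ is non-empty. Let $L_n(\theta)=L_n(\theta;\mathbf X_n)\in[-\infty,\infty)$ be a jointly measurable sample criterion and $\hat\theta=\hat\theta(\mathbf X_n)\in\Theta$. Put $$\mathrm d\Pi_n(\theta\mid\mathbf X_n)=\frac{e^{nL_n(\theta)}\,\mathrm d\Pi(\theta)}{\int_\Theta e^{nL_n}\,\mathrm d\Pi},\qquad Q_n(\theta)=2n\,[L_n(\hat\theta)-L_n(\theta)] .$$ Let $N$ be a fixed neighborhood of $\Theta_I$, let $\gamma:N\to\Gamma\subseteq\mathbb R^{d^*}$, $d^*\ge1$, satisfy $\gamma(\theta)=0\iff\theta\in\Theta_I$, and let $\Theta_{osn}$ be neighborhoods of $\Theta_I$ with $\Theta_{osn}\subseteq N$ for all large $n$. Assume that the neighborhoods are described by $\gamma$ at the scale $n^{-1/2}$: for every $M<\infty$ and all large $n$, up to a $\Pi$-null set, every $\theta\in N$ with $\sqrt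 n\,\|\gamma(\theta)\|\le M$ and $\gamma(\theta)\in\gamma(\Theta_{osn})$ lies in $\Theta_{osn}$. Let $T\subseteq\mathbb R^{d^*}$ be a closed convex cone with positive Lebesgue measure, with metric projection $\mathbf T v=\arg\min_{t\in T}\|v-t\|$, and assume that the sets $T_{osn}=\{\sqrt n\,\gamma(\theta):\theta\in\Theta_{osn}\}$ cover $T$: (a) $\sup_{\|b\|\le M}\big|\inf_{a\in T_{osn}}\|a-b\|^2-\inf_{a\in T}\|a-b\|^2\big|\to0$ for each $M$; (b) there are $k_n\to\infty$ such that the sets $C_n=T_{osn}\cap\{\|x\|\le k_n\}$ are convex, $C_n\subseteq C_{n'}$ for $n\le n'$, and $T=\overline{\bigcup_{n\ge1}C_n}$. **Assumptions.** 1. (Posterior contraction) $L_n(\hat\theta)=\sup_{\theta\in\Theta_{osn}}L_n(\theta)+o_{\mathbb P}(n^{-1})$ and $\Pi_n(\Theta\setminus\Theta_{osn}\mid\mathbf X_n)=o_{\mathbb P}(1)$. 2. (Local quadratic approximation) There are $\mathbf X_n$-measurable $\ell_n\in\mathbb R$ and $\hat\gamma_n\in\mathbb R^{d^*}$ with $$\sup_{\theta\in\Theta_{osn}}\Big|nL_n(\theta)-\Big(\ell_n+\tfrac12\|\sqrt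 n\hat\gamma_n\|^2-\tfrac12\|\sqrt n(\hat\gamma_n-\gamma(\theta))\|^2\Big)\Big|=o_{\mathbb P}(1),$$ $\sup_{\theta\in\Theta_{osn}}\|\gamma(\theta)\|\to0$, and $\sqrt n\hat\gamma_n=\mathbf T\mathbb V_n$ almost surely, where $\mathbb V_n\rightsquigarrow N(0,\Sigma)$ for some positive semidefinite $\Sigma$ (not necessarily $I_{d^*}$). 3. (Prior) $\int_\Theta e^{nL_n}\,\mathrm d\Pi<\infty$ almost surely for each $n\ge1$; and for some $\delta>0$ the measure $\Pi_\Gamma(A)=\Pi(\{\theta\in N:\gamma(\theta)\in A\})$ has a continuous, strictly positive Lebesgue density on $B_\delta\cap\Gamma$, where $B_\delta$ is the ball of radius $\delta$ centered at the origin. **Conclusion.** With $Z\sim N(0,I_{d^*})$ independent of the data, $$\sup_{z\in\mathbb R}\Big|\Pi_n(\{\theta:Q_n(\theta)\le z\}\mid\mathbf X_n)-\mathbb P\big(\|Z\|^2\le z\,\big|\,Z\in T-\sqrt n\hat\gamma_n,\ \mathbf X_n\big)\Big|=o_{\mathbb P}(1).$$ Hence: (i) if $T\ne\mathbb R^{d^*}$,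 then $\sup_{z\in\mathbb R}\big(\Pi_n(\{\theta:Q_n(\theta)\le z\}\mid\mathbf X_n)-F_T(z)\big)^+=o_{\mathbb P}(1)$, where $F_T(z)=\mathbb P(\|\mathbf T Z\|^2\le z)$; (ii) if $T=\mathbb R^{d^*}$, then $\sup_{z\in\mathbb R}\big|\Pi_n(\{\theta:Q_n(\theta)\le z\}\mid\mathbf X_n)-F_{\chi^2_{d^*}}(z)\big|=o_{\mathbb P}(1)$. Here $o_{\mathbb P}$ is understood in outer probability where a quantity is not measurable. -/

import Mathlib

open MeasureTheory ProbabilityTheory Filter Topology Set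
open scoped ENNReal

noncomputable section

namespace QLRPosterior

/-- `X n = o_P(1)` for a sequence of `[0, ∞]`-valued functions on a probability space.
When `X n` is not measurable (a supremum over an uncountable set), `P` is the outer probability. -/
def LittleOP {Ω : Type*} [MeasurableSpace Ω] (P : Measure Ω) (X : ℕ → Ω → ℝ≥0∞) : Prop :=
  ∀ ε : ℝ≥0∞, 0 < ε → Tendsto (fun n => P {ω | ε ≤ X n ω}) atTop (𝓝 0)

/-- The sample of size `n`. -/
def sample {Ω 𝒳 : Type*} (X : ℕ → Ω → 𝒳) (n : ℕ) (ω : Ω) : Fin n → 𝒳 := fun i => X i ω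

/-- The identified set: the set of maximizers of the population objective function. -/
def identifiedSet {Θ : Type*} (L : Θ → ℝ) : Set Θ := {θ | ∀ ϑ, L ϑ ≤ L θ}

/-- The quasi-posterior `dΠₙ(θ) = e^{n Lₙ(θ)} dΠ(θ) / ∫ e^{n Lₙ} dΠ`, where `Ln` is the sample
criterion at the observed data (`-∞` is allowed as a value, with `e^{-∞} = 0`). -/
def quasiPosterior {Θ : Type*} [MeasurableSpace Θ] (prior : Measure Θ) (n : ℕ) (Ln : Θ → EReal) :
    Measure Θ :=
  (∫⁻ θ, EReal.exp (n * Ln θ) ∂prior)⁻¹ • prior.withDensity (fun θ => EReal.exp (n * Ln θ))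

/-- The quasi-likelihood ratio statistic `Qₙ(θ) = 2 n (Lₙ(θhat) - Lₙ(θ))`. -/
def qlr {Θ : Type*} (n : ℕ) (Ln : Θ → EReal) (θhat θ : Θ) : EReal :=
  ((2 * n : ℝ) : EReal) * (Ln θhat - Ln θ)

/-- The quasi-posterior distribution function of the QLR statistic,
`z ↦ Πₙ({θ : Qₙ(θ) ≤ z})`. -/
def postCDF {Θ : Type*} [MeasurableSpace Θ] (prior : Measure Θ) (n : ℕ) (Ln : Θ → EReal)
    (θhat : Θ) (z : ℝ) : ℝ :=
  (quasiPosterior prior n Ln).real {θ | qlr n Ln θhat θ ≤ (z : EReal)}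

variable {d : ℕ}

/-- A (nonrandom) sequence of sets covers a set `T`: squared distances to `A n` converge to squared
distances to `T` uniformly on bounded sets, and there are radii `k n → ∞` for which the sets
`A n ∩ closedBall 0 (k n)` are convex and increasing, with the closure of their union equal
to `T`. -/
def Covers (A : ℕ → Set (EuclideanSpace ℝ (Fin d))) (T : Set (EuclideanSpace ℝ (Fin d))) : Prop :=
  (∀ M : ℝ, Tendsto (fun n => ⨆ b ∈ Metric.closedBall (0 : EuclideanSpace ℝ (Fin d)) M,
      ‖Metric.infDist b (A n) ^ 2 - Metric.infDist b T ^ 2‖ₑ) atTop (𝓝 0)) ∧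
  ∃ k : ℕ → ℝ, Tendsto k atTop atTop ∧
    (∀ n ≥ 1, Convex ℝ (A n ∩ Metric.closedBall 0 (k n))) ∧
    (∀ n ≥ 1, ∀ m ≥ n, A n ∩ Metric.closedBall 0 (k n) ⊆ A m ∩ Metric.closedBall 0 (k m)) ∧
    T = closure (⋃ n ≥ 1, A n ∩ Metric.closedBall 0 (k n))

theorem exists_nearest (T : ProperCone ℝ (EuclideanSpace ℝ (Fin d)))
    (v : EuclideanSpace ℝ (Fin d)) : ∃ p ∈ T, ∀ t ∈ T, ‖v - p‖ ≤ ‖v - t‖ := by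
  obtain ⟨p, hp, h⟩ := T.isClosed.exists_infDist_eq_dist ⟨0, T.zero_mem⟩ v
  refine ⟨p, hp, fun t ht => ?_⟩
  rw [← dist_eq_norm, ← dist_eq_norm, ← h]
  exact Metric.infDist_le_dist_of_mem ht

/-- The metric projection of `v` onto the closed convex cone `T`, i.e. the (unique) minimizer of
`t ↦ ‖v - t‖` over `T`. -/
def coneProj (T : ProperCone ℝ (EuclideanSpace ℝ (Fin d))) (v : EuclideanSpace ℝ (Fin d)) :
    EuclideanSpace ℝ (Fin d) :=
  (exists_nearest T v).choose

theorem coneProj_mem (T : ProperCone ℝ (EuclideanSpace ℝ (Fin d)))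
    (v : EuclideanSpace ℝ (Fin d)) : coneProj T v ∈ T :=
  (exists_nearest T v).choose_spec.1

theorem norm_sub_coneProj_le (T : ProperCone ℝ (EuclideanSpace ℝ (Fin d)))
    (v t : EuclideanSpace ℝ (Fin d)) (ht : t ∈ T) : ‖v - coneProj T v‖ ≤ ‖v - t‖ :=
  (exists_nearest T v).choose_spec.2 t ht

/-- `F_T(z) = P(‖proj_T Z‖² ≤ z)` for a standard normal vector `Z`. -/
def coneCDF (T : ProperCone ℝ (EuclideanSpace ℝ (Fin d))) (z : ℝ) : ℝ :=
  (stdGaussian (EuclideanSpace ℝ (Fin d))).real {x | ‖coneProj T x‖ ^ 2 ≤ z}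

/-- `P(‖Z‖² ≤ z | Z ∈ T - v)` for a standard normal vector `Z`, where `T - v` is the translate
`{t - v : t ∈ T}`. -/
def condNormCDF (T : ProperCone ℝ (EuclideanSpace ℝ (Fin d))) (v : EuclideanSpace ℝ (Fin d))
    (z : ℝ) : ℝ :=
  (ProbabilityTheory.cond (stdGaussian (EuclideanSpace ℝ (Fin d)))
    ((fun t => t - v) '' (T : Set (EuclideanSpace ℝ (Fin d))))).real {x | ‖x‖ ^ 2 ≤ z}

/-- The distribution function of the chi-square distribution with `d` degrees of freedom, i.e. of
the sum of squares of `d` independent standard normal variables. -/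
def chiSqCDF (d : ℕ) (z : ℝ) : ℝ :=
  (Measure.pi fun _ : Fin d => gaussianReal 0 1).real {x | ∑ i, x i ^ 2 ≤ z}

end QLRPosterior

end

/-! Write `g` for the rescaled estimator `√n γhat`, a point of the cone `T`, and `x = √n γ(θ)`. On
the local neighborhood the quadratic approximation makes the likelihood, up to factors `e^{±ε}` and
a constant free of `θ`, the Gaussian kernel `exp(-‖g - x‖²/2)`. At scale `n^{-1/2}` the prior of
`γ(θ)` has nearly constant density, and the values of `x` fill out `T`. The quasi-posterior of `x -
g` is therefore close to a standard normal conditioned on `T - g`. Since `g` lies in `T`, the local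
supremum of the criterion nearly equals the peak of the quadratic, so the QLR statistic is `‖g -
x‖²` up to `8ε` and its posterior law is that of `‖Z‖²` given `Z ∈ T - g`.
`eventually_local_gaussian` gives this uniformly over bounded `g`, and
`abs_postCDF_sub_condNormCDF_le` turns it into a deterministic bound. Only tightness of `V` is then
needed, so the limiting covariance plays no role.

The comparison with `F_T` is a Gaussian correlation inequality. The set `T - g` is stable under
adding `T`, and such a set is negatively correlated with `{‖proj_T Z‖² ≤ z}`, which contains `{‖Z‖²
≤ z}`. For the proof, `Z` in the second event is rotated into an independent copy. The derivative
along the rotation has a sign, because the gradient of `‖proj_T u‖²` is `2 proj_T u`, a direction in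
`T` along which the indicator of the first set increases. If `T` is the whole space, the
conditioning is void and the limit is chi-square. -/

namespace QLRPosterior

/-! ### Projection onto a closed convex cone -/

section ConeProjection

open scoped RealInnerProductSpace

variable {d : ℕ} (T : ProperCone ℝ (EuclideanSpace ℝ (Fin d)))

theorem inner_sub_coneProj_sub_le (v : EuclideanSpace ℝ (Fin d)) {t : EuclideanSpace ℝ (Fin d)}
    (ht : t ∈ T) : ⟪v - coneProj T v, t - coneProj T v⟫ ≤ 0 := by
  refine (norm_eq_iInf_iff_real_inner_le_zero (K := (T : Set (EuclideanSpace ℝ (Fin d))))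
    T.convex (coneProj_mem T v)).1 ?_ t ht
  have : Nonempty (T : Set (EuclideanSpace ℝ (Fin d))) := ⟨⟨0, T.zero_mem⟩⟩
  refine le_antisymm (le_ciInf fun w => norm_sub_coneProj_le T v w w.2) ?_
  exact ciInf_le (f := fun w : (T : Set (EuclideanSpace ℝ (Fin d))) => ‖v - w‖)
    ⟨0, fun _ ⟨_, h⟩ => h ▸ norm_nonneg _⟩ ⟨coneProj T v, coneProj_mem T v⟩

theorem inner_sub_coneProj_self (v : EuclideanSpace ℝ (Fin d)) :
    ⟪v - coneProj T v, coneProj T v⟫ = 0 := by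
  have h0 := inner_sub_coneProj_sub_le T v T.zero_mem
  have h2 := inner_sub_coneProj_sub_le T v (T.smul_mem (coneProj_mem T v) (zero_le_two (α := ℝ)))
  rw [two_smul, add_sub_cancel_right] at h2
  rw [zero_sub, inner_neg_right] at h0
  linarith

theorem inner_sub_coneProj_le (v : EuclideanSpace ℝ (Fin d)) {t : EuclideanSpace ℝ (Fin d)}
    (ht : t ∈ T) : ⟪v - coneProj T v, t⟫ ≤ 0 := by
  have h := inner_sub_coneProj_sub_le T v ht
  rw [inner_sub_right, inner_sub_coneProj_self] at h
  linarith

theorem norm_coneProj_sq (v : EuclideanSpace ℝ (Fin d)) :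
    ‖coneProj T v‖ ^ 2 = ⟪v, coneProj T v⟫ := by
  have h := inner_sub_coneProj_self T v
  rw [inner_sub_left, real_inner_self_eq_norm_sq] at h
  linarith

/-- For `r` in the polar cone, `‖proj x‖² = ⟪x, proj x⟫ ≤ ⟪x - r, proj x⟫`; Cauchy–Schwarz finishes.
-/
theorem norm_coneProj_le_norm_sub (x : EuclideanSpace ℝ (Fin d)) {r : EuclideanSpace ℝ (Fin d)}
    (hr : ∀ t ∈ T, ⟪r, t⟫ ≤ 0) : ‖coneProj T x‖ ≤ ‖x - r‖ := by
  have h1 : ‖coneProj T x‖ ^ 2 ≤ ‖x - r‖ * ‖coneProj T x‖ := by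
    refine le_trans ?_ (real_inner_le_norm _ _)
    rw [norm_coneProj_sq, inner_sub_left]
    linarith [hr _ (coneProj_mem T x)]
  by_contra! h
  nlinarith [norm_nonneg (x - r)]

theorem norm_coneProj_le (x : EuclideanSpace ℝ (Fin d)) : ‖coneProj T x‖ ≤ ‖x‖ := by
  simpa using norm_coneProj_le_norm_sub T x (r := 0) (by simp)

theorem norm_coneProj_add_sq_le (v w : EuclideanSpace ℝ (Fin d)) :
    ‖coneProj T (v + w)‖ ^ 2 ≤ ‖coneProj T v‖ ^ 2 + 2 * ⟪coneProj T v, w⟫ + ‖w‖ ^ 2 := by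
  rw [← norm_add_sq_real]
  have h := norm_coneProj_le_norm_sub T (v + w) (r := v - coneProj T v)
    fun t ht => inner_sub_coneProj_le T v ht
  rw [show v + w - (v - coneProj T v) = coneProj T v + w by abel] at h
  gcongr

theorem le_norm_coneProj_add_sq (v w : EuclideanSpace ℝ (Fin d)) :
    ‖coneProj T v‖ ^ 2 + 2 * ⟪coneProj T v, w⟫ ≤ ‖coneProj T (v + w)‖ ^ 2 := by
  have h := norm_sub_coneProj_le T (v + w) _ (coneProj_mem T v)
  have h' : ‖v + w - coneProj T (v + w)‖ ^ 2 ≤ ‖v + w - coneProj T v‖ ^ 2 := by gcongr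
  rw [norm_sub_sq_real, norm_sub_sq_real, ← norm_coneProj_sq, inner_add_left,
    ← norm_coneProj_sq, real_inner_comm] at h'
  linarith

/-- The two preceding bounds pinch the increment between its linear part and that part plus `‖w‖²`.
The squared norm is thus differentiable everywhere, with no differentiability of the projection
itself required. -/
theorem hasFDerivAt_norm_coneProj_sq (v : EuclideanSpace ℝ (Fin d)) :
    HasFDerivAt (fun x => ‖coneProj T x‖ ^ 2) ((2 : ℝ) • innerSL ℝ (coneProj T v)) v := by
  rw [hasFDerivAt_iff_isLittleO_nhds_zero]
  refine Asymptotics.IsBigO.trans_isLittleO (g := fun w => ‖w‖ ^ 2) ?_ ?_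
  · refine Asymptotics.IsBigO.of_bound 1 (Eventually.of_forall fun w => ?_)
    have h1 := norm_coneProj_add_sq_le T v w
    have h2 := le_norm_coneProj_add_sq T v w
    simp only [_root_.smul_apply, innerSL_apply_apply, smul_eq_mul, one_mul,
      Real.norm_eq_abs]
    rw [abs_of_nonneg (by linarith), abs_of_nonneg (sq_nonneg ‖w‖)]
    linarith
  · exact Asymptotics.isLittleO_norm_pow_id one_lt_two

theorem continuous_norm_coneProj_sq : Continuous fun x => ‖coneProj T x‖ ^ 2 :=
  continuous_iff_continuousAt.2 fun v => (hasFDerivAt_norm_coneProj_sq T v).continuousAt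

theorem norm_coneProj_sub_le (v w : EuclideanSpace ℝ (Fin d)) :
    ‖coneProj T v - coneProj T w‖ ≤ ‖v - w‖ := by
  have h1 := inner_sub_coneProj_sub_le T v (coneProj_mem T w)
  have h2 := inner_sub_coneProj_sub_le T w (coneProj_mem T v)
  have h3 : ‖coneProj T v - coneProj T w‖ ^ 2
      ≤ ‖v - w‖ * ‖coneProj T v - coneProj T w‖ := by
    refine le_trans ?_ (real_inner_le_norm _ _)
    rw [← real_inner_self_eq_norm_sq]
    simp only [inner_sub_left, inner_sub_right] at *
    linarith
  by_contra! h
  nlinarith [norm_nonneg (v - w)]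

theorem continuous_coneProj : Continuous (coneProj T) :=
  (LipschitzWith.of_dist_le_mul (K := 1) fun v w => by
    simpa [dist_eq_norm] using norm_coneProj_sub_le T v w).continuous

end ConeProjection

/-! ### Gaussian correlation inequality for cones -/

section GaussianConeInequality

open scoped RealInnerProductSpace

variable {d : ℕ} (T : ProperCone ℝ (EuclideanSpace ℝ (Fin d)))

/-- A bounded function that increases along `c`, evaluated at `a - s • w`, is negatively correlated
with `⟪c, w⟫` under the standard Gaussian measure. -/
theorem integral_mul_inner_stdGaussian_nonpos {f : EuclideanSpace ℝ (Fin d) → ℝ}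
    (hf : Measurable f) (hf1 : ∀ x, |f x| ≤ 1) {c : EuclideanSpace ℝ (Fin d)}
    (hfc : ∀ x, ∀ r : ℝ, 0 ≤ r → f x ≤ f (x + r • c)) (a : EuclideanSpace ℝ (Fin d))
    {s : ℝ} (hs : 0 ≤ s) :
    ∫ w, f (a - s • w) * ⟪c, w⟫ ∂(stdGaussian (EuclideanSpace ℝ (Fin d))) ≤ 0 := by
  set μ := stdGaussian (EuclideanSpace ℝ (Fin d))
  rcases eq_or_ne c 0 with rfl | hc
  · simp
  -- Reflection in the hyperplane orthogonal to `c` preserves the Gaussian measure and flips the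
  -- sign of `⟪c, w⟫`.
  let R : EuclideanSpace ℝ (Fin d) ≃ₗᵢ[ℝ] EuclideanSpace ℝ (Fin d) := (ℝ ∙ c)ᗮ.reflection
  have hR : ∀ w, R w = w - (2 * (⟪c, w⟫ / ‖c‖ ^ 2)) • c := by
    intro w
    simp only [R]
    rw [Submodule.reflection_orthogonal_apply, Submodule.reflection_singleton_apply]
    simp [two_smul, two_mul, add_smul]
  have hRc : ∀ w, ⟪c, R w⟫ = -⟪c, w⟫ := by
    intro w
    have : ‖c‖ ^ 2 ≠ 0 := by positivity
    rw [hR, inner_sub_right, inner_smul_right, real_inner_self_eq_norm_sq]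
    field_simp
    ring
  have hint : ∀ A : EuclideanSpace ℝ (Fin d) → EuclideanSpace ℝ (Fin d), Measurable A →
      Integrable (fun w => f (A w) * ⟪c, w⟫) μ := by
    intro A hA
    refine Integrable.bdd_mul (c := 1) ?_ (hf.comp hA).aestronglyMeasurable
      (Eventually.of_forall fun w => hf1 _)
    exact (innerSL ℝ c).integrable_comp IsGaussian.integrable_id
  have hmp : MeasurePreserving R μ μ := ⟨R.continuous.measurable, stdGaussian_map R⟩
  have h1 : ∫ w, f (a - s • w) * ⟪c, w⟫ ∂μ = ∫ w, f (a - s • R w) * ⟪c, R w⟫ ∂μ :=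
    (hmp.integral_comp R.toHomeomorph.measurableEmbedding
      (fun w => f (a - s • w) * ⟪c, w⟫)).symm
  have h2 : ∫ w, f (a - s • R w) * ⟪c, R w⟫ ∂μ = -∫ w, f (a - s • R w) * ⟪c, w⟫ ∂μ := by
    rw [← integral_neg]
    simp [hRc]
  have hRm : Measurable R := R.continuous.measurable
  -- When `⟪c, w⟫ ≥ 0`, reflecting `w` moves `a - s • w` forward along `c`; when `⟪c, w⟫ ≤ 0` it
  -- moves it backward, but the weight is then nonpositive. The integrand does not decrease in
  -- either case.
  have h3 : ∫ w, f (a - s • w) * ⟪c, w⟫ ∂μ ≤ ∫ w, f (a - s • R w) * ⟪c, w⟫ ∂μ := by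
    refine integral_mono (hint _ (by fun_prop)) (hint _ (by fun_prop)) fun w => ?_
    have e : a - s • R w = (a - s • w) + (s * (2 * (⟪c, w⟫ / ‖c‖ ^ 2))) • c := by
      rw [hR, smul_sub, smul_smul]
      abel
    have hc2 : (0 : ℝ) < ‖c‖ ^ 2 := by positivity
    rcases le_total 0 ⟪c, w⟫ with h | h
    · refine mul_le_mul_of_nonneg_right ?_ h
      rw [e]
      exact hfc _ _ (by positivity)
    · refine mul_le_mul_of_nonpos_right ?_ h
      have e' : a - s • w = (a - s • R w) + (s * (2 * (-⟪c, w⟫ / ‖c‖ ^ 2))) • c := by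
        rw [e, add_assoc, ← add_smul]
        ring_nf
        simp
      rw [e']
      exact hfc _ _ (mul_nonneg hs (mul_nonneg zero_le_two
        (div_nonneg (neg_nonneg.2 h) hc2.le)))
  linarith

/-- Negative correlation under the standard Gaussian measure of a function that increases along `T`
and a smooth decreasing function of `‖proj_T ·‖²`. -/
theorem integral_mul_comp_norm_coneProj_sq_le {f : EuclideanSpace ℝ (Fin d) → ℝ}
    (hf : Measurable f) (hf1 : ∀ x, |f x| ≤ 1) (hfT : ∀ x, ∀ c ∈ T, f x ≤ f (x + c))
    {ψ ψ' : ℝ → ℝ} (hψ : ∀ r, HasDerivAt ψ (ψ' r) r) (hψ'c : Continuous ψ') {C : ℝ}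
    (hψ'C : ∀ r, |ψ' r| ≤ C) (hψ'n : ∀ r, ψ' r ≤ 0) (hψ1 : ∀ r, |ψ r| ≤ 1) :
    ∫ x, f x * ψ (‖coneProj T x‖ ^ 2) ∂(stdGaussian (EuclideanSpace ℝ (Fin d))) ≤
      (∫ x, f x ∂(stdGaussian (EuclideanSpace ℝ (Fin d)))) *
        ∫ x, ψ (‖coneProj T x‖ ^ 2) ∂(stdGaussian (EuclideanSpace ℝ (Fin d))) := by
  set μ := stdGaussian (EuclideanSpace ℝ (Fin d)) with hμ
  have hC : 0 ≤ C := (abs_nonneg _).trans (hψ'C 0)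
  have hψc : Continuous ψ := continuous_iff_continuousAt.2 fun r => (hψ r).continuousAt
  have hq := continuous_norm_coneProj_sq T
  have hp := continuous_coneProj T
  -- `(U, W)` is the rotated pair: `U` runs from the first copy at angle `0` to the independent
  -- second copy at `π / 2`, and `W` is its velocity.
  let U : ℝ → EuclideanSpace ℝ (Fin d) × EuclideanSpace ℝ (Fin d) → EuclideanSpace ℝ (Fin d) :=
    fun θ p => Real.cos θ • p.1 + Real.sin θ • p.2
  let W : ℝ → EuclideanSpace ℝ (Fin d) × EuclideanSpace ℝ (Fin d) → EuclideanSpace ℝ (Fin d) :=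
    fun θ p => -Real.sin θ • p.1 + Real.cos θ • p.2
  have hUc : ∀ θ, Continuous (U θ) := fun θ => by fun_prop
  have hWc : ∀ θ, Continuous (W θ) := fun θ => by fun_prop
  have hUn : ∀ θ p, ‖U θ p‖ ≤ ‖p.1‖ + ‖p.2‖ := by
    intro θ p
    refine (norm_add_le _ _).trans ?_
    rw [norm_smul, norm_smul]
    exact add_le_add (mul_le_of_le_one_left (norm_nonneg _) (Real.abs_cos_le_one θ))
      (mul_le_of_le_one_left (norm_nonneg _) (Real.abs_sin_le_one θ))
  have hWn : ∀ θ p, ‖W θ p‖ ≤ ‖p.1‖ + ‖p.2‖ := by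
    intro θ p
    refine (norm_add_le _ _).trans ?_
    rw [norm_smul, norm_smul, norm_neg]
    exact add_le_add (mul_le_of_le_one_left (norm_nonneg _) (Real.abs_sin_le_one θ))
      (mul_le_of_le_one_left (norm_nonneg _) (Real.abs_cos_le_one θ))
  have hUd : ∀ p θ, HasDerivAt (fun θ => U θ p) (W θ p) θ := fun p θ =>
    ((Real.hasDerivAt_cos θ).smul_const p.1).add ((Real.hasDerivAt_sin θ).smul_const p.2)
  let F : ℝ → EuclideanSpace ℝ (Fin d) × EuclideanSpace ℝ (Fin d) → ℝ :=
    fun θ p => f p.1 * ψ (‖coneProj T (U θ p)‖ ^ 2)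
  let F' : ℝ → EuclideanSpace ℝ (Fin d) × EuclideanSpace ℝ (Fin d) → ℝ :=
    fun θ p => f p.1 * (ψ' (‖coneProj T (U θ p)‖ ^ 2) * (2 * ⟪coneProj T (U θ p), W θ p⟫))
  have hf_fst : AEStronglyMeasurable
      (fun p : EuclideanSpace ℝ (Fin d) × EuclideanSpace ℝ (Fin d) => f p.1) (μ.prod μ) :=
    (hf.comp measurable_fst).aestronglyMeasurable
  have hFm : ∀ θ, AEStronglyMeasurable (F θ) (μ.prod μ) := fun θ =>
    hf_fst.mul (hψc.comp (hq.comp (hUc θ))).aestronglyMeasurable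
  have hF'm : ∀ θ, AEStronglyMeasurable (F' θ) (μ.prod μ) := fun θ =>
    hf_fst.mul ((hψ'c.comp (hq.comp (hUc θ))).mul
      (continuous_const.mul ((hp.comp (hUc θ)).inner (hWc θ)))).aestronglyMeasurable
  have hsq : Integrable (fun x : EuclideanSpace ℝ (Fin d) => ‖x‖ ^ 2) μ :=
    (IsGaussian.memLp_two_id (μ := μ)).integrable_norm_pow two_ne_zero
  let bound : EuclideanSpace ℝ (Fin d) × EuclideanSpace ℝ (Fin d) → ℝ :=
    fun p => C * (2 * (2 * ‖p.1‖ ^ 2 + 2 * ‖p.2‖ ^ 2))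
  have hbound : Integrable bound (μ.prod μ) :=
    ((((hsq.comp_fst μ).const_mul 2).add ((hsq.comp_snd μ).const_mul 2)).const_mul 2).const_mul C
  have hinner_le : ∀ u w : EuclideanSpace ℝ (Fin d), |ψ' (‖coneProj T u‖ ^ 2) *
      (2 * ⟪coneProj T u, w⟫)| ≤ C * (2 * (‖u‖ * ‖w‖)) := by
    intro u w
    rw [abs_mul, abs_mul, abs_two]
    gcongr
    · exact hψ'C _
    · exact (abs_real_inner_le_norm _ _).trans
        (mul_le_mul_of_nonneg_right (norm_coneProj_le T u) (norm_nonneg _))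
  have hF'b : ∀ θ p, ‖F' θ p‖ ≤ bound p := by
    intro θ p
    rw [Real.norm_eq_abs, abs_mul]
    refine (mul_le_of_le_one_left (abs_nonneg _) (hf1 _)).trans
      ((hinner_le _ _).trans ?_)
    refine mul_le_mul_of_nonneg_left (mul_le_mul_of_nonneg_left ?_ zero_le_two) hC
    refine (mul_le_mul (hUn θ p) (hWn θ p) (norm_nonneg _) (by positivity)).trans ?_
    nlinarith [sq_nonneg (‖p.1‖ - ‖p.2‖)]
  have hF1 : ∀ θ p, ‖F θ p‖ ≤ 1 := by
    intro θ p
    rw [Real.norm_eq_abs, abs_mul]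
    exact mul_le_one₀ (hf1 _) (abs_nonneg _) (hψ1 _)
  have hFi : ∀ θ, Integrable (F θ) (μ.prod μ) := fun θ =>
    Integrable.of_bound (hFm θ) 1 (Eventually.of_forall (hF1 θ))
  have hFd : ∀ p θ, HasDerivAt (fun θ => F θ p) (F' θ p) θ := by
    intro p θ
    have h1 := (hasFDerivAt_norm_coneProj_sq T (U θ p)).comp_hasDerivAt θ (hUd p θ)
    exact ((hψ _).comp θ h1).const_mul (f p.1)
  have hderiv : ∀ θ, HasDerivAt (fun θ => ∫ p, F θ p ∂(μ.prod μ))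
      (∫ p, F' θ p ∂(μ.prod μ)) θ := fun θ =>
    (hasDerivAt_integral_of_dominated_loc_of_deriv_le (s := univ) (bound := bound) univ_mem
      (Eventually.of_forall hFm) (hFi θ) (hF'm θ)
      (Eventually.of_forall fun p θ _ => hF'b θ p) hbound
      (Eventually.of_forall fun p θ _ => hFd p θ)).2
  have hpos : ∀ θ ∈ Icc 0 (Real.pi / 2), 0 ≤ ∫ p, F' θ p ∂(μ.prod μ) := by
    intro θ hθ
    have hs : 0 ≤ Real.sin θ :=
      Real.sin_nonneg_of_nonneg_of_le_pi hθ.1 (hθ.2.trans (by linarith [Real.pi_pos]))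
    -- The derivative in rotated coordinates: `(U, W)` again has law `μ.prod μ`, and the first copy
    -- equals `cos θ • U - sin θ • W`. With `U` fixed, the direction `coneProj T U` is constant and
    -- the reflection lemma applies.
    let G : EuclideanSpace ℝ (Fin d) × EuclideanSpace ℝ (Fin d) → ℝ := fun p =>
      f (Real.cos θ • p.1 - Real.sin θ • p.2) *
        (ψ' (‖coneProj T p.1‖ ^ 2) * (2 * ⟪coneProj T p.1, p.2⟫))
    have hGm : AEStronglyMeasurable G (μ.prod μ) := by
      refine AEStronglyMeasurable.mul (Measurable.aestronglyMeasurable ?_)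
        (Continuous.aestronglyMeasurable ?_)
      · exact hf.comp (by fun_prop)
      · exact (hψ'c.comp (hq.comp continuous_fst)).mul
          (continuous_const.mul ((hp.comp continuous_fst).inner continuous_snd))
    have hGi : Integrable G (μ.prod μ) := by
      refine hbound.mono' hGm (Eventually.of_forall fun p => ?_)
      rw [Real.norm_eq_abs, abs_mul]
      refine (mul_le_of_le_one_left (abs_nonneg _) (hf1 _)).trans
        ((hinner_le _ _).trans ?_)
      refine mul_le_mul_of_nonneg_left (mul_le_mul_of_nonneg_left ?_ zero_le_two) hC
      nlinarith [sq_nonneg (‖p.1‖ - ‖p.2‖)]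
    have hrot : (μ.prod μ).map (ContinuousLinearMap.rotation θ) = μ.prod μ :=
      IsGaussian.map_rotation_eq_self integral_id_stdGaussian θ
    have hFG : ∀ p, F' θ p = G (ContinuousLinearMap.rotation θ p) := by
      intro p
      have e : p.1 = Real.cos θ • U θ p - Real.sin θ • W θ p := by
        simp only [U, W, smul_add, smul_smul]
        rw [show Real.cos θ * Real.sin θ = Real.sin θ * Real.cos θ from mul_comm _ _,
          add_sub_add_right_eq_sub, ← sub_smul]
        rw [show Real.cos θ * Real.cos θ - Real.sin θ * -Real.sin θ = 1 by
          linear_combination Real.sin_sq_add_cos_sq θ, one_smul]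
      simp only [F', G, ContinuousLinearMap.rotation_apply]
      rw [show Real.cos θ • p.1 + Real.sin θ • p.2 = U θ p from rfl,
        show -Real.sin θ • p.1 + Real.cos θ • p.2 = W θ p from rfl, ← e]
    have hint : ∫ p, F' θ p ∂(μ.prod μ) = ∫ p, G p ∂(μ.prod μ) := by
      rw [integral_congr_ae (Eventually.of_forall hFG)]
      conv_rhs => rw [← hrot]
      rw [integral_map (ContinuousLinearMap.continuous _).aemeasurable (by rwa [hrot])]
    rw [hint, integral_prod _ hGi]
    refine integral_nonneg fun u => ?_
    have hu := integral_mul_inner_stdGaussian_nonpos hf hf1 (c := coneProj T u)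
      (fun x r hr => hfT x _ (T.smul_mem (coneProj_mem T u) hr)) (Real.cos θ • u) hs
    have e : ∀ w, G (u, w) = (ψ' (‖coneProj T u‖ ^ 2) * 2) *
        (f (Real.cos θ • u - Real.sin θ • w) * ⟪coneProj T u, w⟫) := fun w => by
      simp only [G]
      ring
    simp only [e, integral_const_mul]
    exact mul_nonneg_of_nonpos_of_nonpos
      (mul_nonpos_of_nonpos_of_nonneg (hψ'n _) zero_le_two) hu
  have hmono : MonotoneOn (fun θ => ∫ p, F θ p ∂(μ.prod μ)) (Icc 0 (Real.pi / 2)) := by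
    refine monotoneOn_of_deriv_nonneg (convex_Icc _ _)
      (fun θ _ => (hderiv θ).continuousAt.continuousWithinAt)
      (fun θ _ => (hderiv θ).differentiableAt.differentiableWithinAt) fun θ hθ => ?_
    rw [(hderiv θ).deriv]
    exact hpos θ (interior_subset hθ)
  have hle := hmono (left_mem_Icc.2 (by positivity)) (right_mem_Icc.2 (by positivity))
    (by positivity : (0 : ℝ) ≤ Real.pi / 2)
  simp only [F, U, Real.cos_zero, Real.sin_zero, one_smul, zero_smul, add_zero,
    Real.cos_pi_div_two, Real.sin_pi_div_two, zero_add] at hle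
  rw [integral_prod_mul f (fun x => ψ (‖coneProj T x‖ ^ 2)),
    integral_fun_fst (fun x => f x * ψ (‖coneProj T x‖ ^ 2))] at hle
  simpa using hle

/-- A set that is stable under adding `T` is negatively correlated with `{‖proj_T ·‖² ≤ z}`. -/
theorem stdGaussian_real_inter_le (K : Set (EuclideanSpace ℝ (Fin d))) (hK : MeasurableSet K)
    (hKT : ∀ x ∈ K, ∀ c ∈ T, x + c ∈ K) (z : ℝ) :
    (stdGaussian (EuclideanSpace ℝ (Fin d))).real (K ∩ {x | ‖coneProj T x‖ ^ 2 ≤ z}) ≤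
      (stdGaussian (EuclideanSpace ℝ (Fin d))).real K * coneCDF T z := by
  set μ := stdGaussian (EuclideanSpace ℝ (Fin d)) with hμ
  have hq := continuous_norm_coneProj_sq T
  have hB : MeasurableSet {x | ‖coneProj T x‖ ^ 2 ≤ z} :=
    (isClosed_le hq continuous_const).measurableSet
  let f : EuclideanSpace ℝ (Fin d) → ℝ := K.indicator 1
  have hf : Measurable f := measurable_one.indicator hK
  have hf1 : ∀ x, |f x| ≤ 1 := fun x => by
    by_cases hx : x ∈ K <;> simp [f, hx]
  have hfT : ∀ x, ∀ c ∈ T, f x ≤ f (x + c) := fun x c hc => by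
    by_cases hx : x ∈ K
    · simp [f, hx, hKT x hx c hc]
    · rw [show f x = 0 by simp [f, hx]]
      exact indicator_nonneg (fun _ _ => by simp) _
  -- Smooth decreasing functions that converge pointwise to the indicator of `Iic z`, with exact
  -- value `1` at `z` itself.
  let ψ : ℕ → ℝ → ℝ := fun k r => 1 - Real.smoothTransition (k * (r - z))
  have hsd : Differentiable ℝ Real.smoothTransition :=
    (Real.smoothTransition.contDiff (n := 1)).differentiable one_ne_zero
  have hsc : Continuous (deriv Real.smoothTransition) :=
    (Real.smoothTransition.contDiff (n := 1)).continuous_deriv le_rfl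
  have hmono : Monotone Real.smoothTransition := Real.smoothTransition.monotone
  obtain ⟨C, hC⟩ : ∃ C, ∀ r, |deriv Real.smoothTransition r| ≤ C := by
    have hcs : HasCompactSupport (deriv Real.smoothTransition) := by
      refine HasCompactSupport.intro (isCompact_Icc (a := (0 : ℝ)) (b := 1)) fun r hr => ?_
      rw [mem_Icc, not_and_or, not_le, not_le] at hr
      rcases hr with hr | hr
      · have : Real.smoothTransition =ᶠ[𝓝 r] fun _ => (0 : ℝ) := by
          filter_upwards [Iio_mem_nhds hr] with x hx
          exact Real.smoothTransition.zero_of_nonpos (le_of_lt hx)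
        rw [this.deriv_eq, deriv_const]
      · have : Real.smoothTransition =ᶠ[𝓝 r] fun _ => (1 : ℝ) := by
          filter_upwards [Ioi_mem_nhds hr] with x hx
          exact Real.smoothTransition.one_of_one_le (le_of_lt hx)
        rw [this.deriv_eq, deriv_const]
    obtain ⟨C, hC⟩ := hcs.exists_bound_of_continuous hsc
    exact ⟨C, hC⟩
  have hψ01 : ∀ k r, 0 ≤ ψ k r ∧ ψ k r ≤ 1 := fun k r =>
    ⟨sub_nonneg.2 (Real.smoothTransition.le_one _),
      sub_le_self _ (Real.smoothTransition.nonneg _)⟩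
  have hψabs : ∀ k r, |ψ k r| ≤ 1 := fun k r => by
    rw [abs_of_nonneg (hψ01 k r).1]
    exact (hψ01 k r).2
  have hψd : ∀ k r, HasDerivAt (ψ k) (-(deriv Real.smoothTransition (k * (r - z)) * k)) r := by
    intro k r
    have h1 : HasDerivAt (fun r : ℝ => (k : ℝ) * (r - z)) k r := by
      simpa using ((hasDerivAt_id r).sub_const z).const_mul (k : ℝ)
    exact ((hsd _).hasDerivAt.comp r h1).const_sub 1
  have hle : ∀ k, ∫ x, f x * ψ k (‖coneProj T x‖ ^ 2) ∂μ ≤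
      (∫ x, f x ∂μ) * ∫ x, ψ k (‖coneProj T x‖ ^ 2) ∂μ := fun k =>
    integral_mul_comp_norm_coneProj_sq_le T hf hf1 hfT (hψd k) (by fun_prop) (C := C * k)
      (fun r => by
        rw [abs_neg, abs_mul, Nat.abs_cast]
        exact mul_le_mul_of_nonneg_right (hC _) (Nat.cast_nonneg _))
      (fun r => neg_nonpos.2 (mul_nonneg hmono.deriv_nonneg (Nat.cast_nonneg _)))
      (hψabs k)
  have hlim : ∀ r, Tendsto (fun k => ψ k r) atTop (𝓝 ((Iic z).indicator 1 r)) := by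
    intro r
    rcases le_or_gt r z with h | h
    · rw [indicator_of_mem (show r ∈ Iic z from h)]
      refine tendsto_const_nhds.congr fun k => ?_
      simp only [ψ, Pi.one_apply]
      rw [Real.smoothTransition.zero_of_nonpos, sub_zero]
      exact mul_nonpos_of_nonneg_of_nonpos (Nat.cast_nonneg _) (sub_nonpos.2 h)
    · rw [indicator_of_notMem (show r ∉ Iic z from not_le.2 h)]
      obtain ⟨k₀, hk₀⟩ := exists_nat_ge (1 / (r - z))
      refine tendsto_const_nhds.congr' ?_
      filter_upwards [eventually_ge_atTop k₀] with k hk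
      simp only [ψ]
      rw [Real.smoothTransition.one_of_one_le, sub_self]
      have hrz : 0 < r - z := sub_pos.2 h
      rw [div_le_iff₀ hrz] at hk₀
      exact hk₀.trans (mul_le_mul_of_nonneg_right (Nat.cast_le.2 hk) hrz.le)
  have hψm : ∀ k, Continuous fun x => ψ k (‖coneProj T x‖ ^ 2) := fun k =>
    (continuous_iff_continuousAt.2 fun r => (hψd k r).continuousAt).comp hq
  have hL : Tendsto (fun k => ∫ x, f x * ψ k (‖coneProj T x‖ ^ 2) ∂μ) atTop
      (𝓝 (∫ x, f x * (Iic z).indicator 1 (‖coneProj T x‖ ^ 2) ∂μ)) := by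
    refine tendsto_integral_of_dominated_convergence (fun _ => 1)
      (fun k => hf.aestronglyMeasurable.mul (hψm k).aestronglyMeasurable)
      (integrable_const _) (fun k => Eventually.of_forall fun x => ?_)
      (Eventually.of_forall fun x => (hlim _).const_mul _)
    rw [Real.norm_eq_abs, abs_mul]
    exact mul_le_one₀ (hf1 _) (abs_nonneg _) (hψabs _ _)
  have hR : Tendsto (fun k => ∫ x, ψ k (‖coneProj T x‖ ^ 2) ∂μ) atTop
      (𝓝 (∫ x, (Iic z).indicator 1 (‖coneProj T x‖ ^ 2) ∂μ)) :=
    tendsto_integral_of_dominated_convergence (fun _ => 1)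
      (fun k => (hψm k).aestronglyMeasurable)
      (integrable_const _) (fun k => Eventually.of_forall fun x => hψabs _ _)
      (Eventually.of_forall fun x => hlim _)
  have hfin := le_of_tendsto_of_tendsto' hL (hR.const_mul _) hle
  have e1 : ∀ x, (Iic z).indicator (1 : ℝ → ℝ) (‖coneProj T x‖ ^ 2) =
      {x | ‖coneProj T x‖ ^ 2 ≤ z}.indicator 1 x := fun x => rfl
  have e2 : ∀ x, f x * {x | ‖coneProj T x‖ ^ 2 ≤ z}.indicator 1 x =
      (K ∩ {x | ‖coneProj T x‖ ^ 2 ≤ z}).indicator 1 x := fun x => by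
    rw [inter_indicator_one]
    rfl
  simp only [e1, e2] at hfin
  rw [integral_indicator_one (hK.inter hB), integral_indicator_one hK,
    integral_indicator_one hB] at hfin
  exact hfin

theorem isClosed_image_sub (v : EuclideanSpace ℝ (Fin d)) :
    IsClosed ((fun t => t - v) '' (T : Set (EuclideanSpace ℝ (Fin d)))) :=
  (Homeomorph.subRight v).isClosedMap _ T.isClosed

theorem mem_image_sub_iff {v x : EuclideanSpace ℝ (Fin d)} :
    x ∈ (fun t => t - v) '' (T : Set (EuclideanSpace ℝ (Fin d))) ↔ x + v ∈ T := by
  constructor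
  · rintro ⟨t, ht, rfl⟩
    simpa using ht
  · exact fun h => ⟨x + v, h, by simp⟩

theorem condNormCDF_eq (v : EuclideanSpace ℝ (Fin d)) (z : ℝ) :
    condNormCDF T v z =
      (stdGaussian (EuclideanSpace ℝ (Fin d))).real ({x | x + v ∈ T} ∩ {x | ‖x‖ ^ 2 ≤ z}) /
        (stdGaussian (EuclideanSpace ℝ (Fin d))).real {x | x + v ∈ T} := by
  have e : (fun t => t - v) '' (T : Set (EuclideanSpace ℝ (Fin d))) = {x | x + v ∈ T} := by
    ext x
    exact mem_image_sub_iff T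
  rw [condNormCDF, measureReal_def, cond_apply (isClosed_image_sub T v).measurableSet, e,
    ENNReal.toReal_mul, ENNReal.toReal_inv, div_eq_inv_mul]
  rfl

theorem measurableSet_add_mem (v : EuclideanSpace ℝ (Fin d)) :
    MeasurableSet {x | x + v ∈ T} :=
  (T.isClosed.preimage (f := fun x => x + v) (by fun_prop)).measurableSet

/-- The projection does not increase norms, so the ball event only grows when `‖x‖` is replaced by
`‖proj x‖`; `T + T ⊆ T` makes `T - v` stable under `T`. A null conditioning event is harmless, as
the quotient is then `0`. -/
theorem condNormCDF_le_coneCDF (v : EuclideanSpace ℝ (Fin d)) (z : ℝ) :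
    condNormCDF T v z ≤ coneCDF T z := by
  rw [condNormCDF_eq]
  refine div_le_of_le_mul₀ measureReal_nonneg measureReal_nonneg ?_
  rw [mul_comm]
  refine le_trans (measureReal_mono ?_) (stdGaussian_real_inter_le T _
    (measurableSet_add_mem T v) (fun x hx c hc => ?_) z)
  · refine inter_subset_inter_right _ fun x (hx : ‖x‖ ^ 2 ≤ z) => ?_
    exact le_trans (pow_le_pow_left₀ (norm_nonneg _) (norm_coneProj_le T x) 2) hx
  · rw [mem_ofPred_eq, add_right_comm]
    exact T.add_mem hx hc

end GaussianConeInequality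

end QLRPosterior

namespace QLRPosterior

/-! ### Lebesgue density of the standard Gaussian -/

section GaussianDensity

open scoped RealInnerProductSpace

/-- The normalizing constant of the standard Gaussian density on `ℝᵈ`. -/
noncomputable def gaussianConst (d : ℕ) : ℝ≥0∞ :=
  ENNReal.ofReal ((2 * Real.pi) ^ (d / 2 : ℝ))⁻¹

variable {d : ℕ}

theorem gaussianConst_ne_zero : gaussianConst d ≠ 0 := by
  have : 0 < ((2 * Real.pi) ^ (d / 2 : ℝ))⁻¹ := by positivity
  simpa [gaussianConst] using this

theorem gaussianConst_ne_top : gaussianConst d ≠ ∞ := ENNReal.ofReal_ne_top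

theorem lintegral_exp_neg_half_mul_norm_sq :
    ∫⁻ x : EuclideanSpace ℝ (Fin d), ENNReal.ofReal (Real.exp (-(1 / 2) * ‖x‖ ^ 2)) =
      (gaussianConst d)⁻¹ := by
  have h := GaussianFourier.integral_rexp_neg_mul_sq_norm (V := EuclideanSpace ℝ (Fin d))
    (b := 1 / 2) (by norm_num)
  have hpos : (0 : ℝ) < (2 * Real.pi) ^ (d / 2 : ℝ) := by positivity
  have hval : ∫ v : EuclideanSpace ℝ (Fin d), Real.exp (-(1 / 2) * ‖v‖ ^ 2) =
      (2 * Real.pi) ^ (d / 2 : ℝ) := by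
    rw [h, finrank_euclideanSpace_fin]
    congr 1
    ring
  rw [← ofReal_integral_eq_lintegral_ofReal
    (Integrable.of_integral_ne_zero (by rw [hval]; exact hpos.ne'))
    (Eventually.of_forall fun x => (Real.exp_pos _).le), hval, gaussianConst,
    ENNReal.ofReal_inv_of_pos hpos, inv_inv]

theorem stdGaussian_eq_withDensity :
    stdGaussian (EuclideanSpace ℝ (Fin d)) = gaussianConst d •
      (volume : Measure (EuclideanSpace ℝ (Fin d))).withDensity
        fun x => ENNReal.ofReal (Real.exp (-(1 / 2) * ‖x‖ ^ 2)) := by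
  have hm : Measurable fun x : EuclideanSpace ℝ (Fin d) =>
      ENNReal.ofReal (Real.exp (-(1 / 2) * ‖x‖ ^ 2)) := by fun_prop
  have hfin : IsFiniteMeasure (gaussianConst d •
      (volume : Measure (EuclideanSpace ℝ (Fin d))).withDensity
        fun x => ENNReal.ofReal (Real.exp (-(1 / 2) * ‖x‖ ^ 2))) := by
    refine ⟨?_⟩
    rw [Measure.smul_apply, withDensity_apply _ MeasurableSet.univ, Measure.restrict_univ,
      lintegral_exp_neg_half_mul_norm_sq, smul_eq_mul,
      ENNReal.mul_inv_cancel gaussianConst_ne_zero gaussianConst_ne_top]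
    exact ENNReal.one_lt_top
  refine Measure.ext_of_charFun (funext fun t => ?_)
  rw [charFun_stdGaussian, charFun_apply, integral_smul_measure,
    integral_withDensity_eq_integral_toReal_smul hm
      (Eventually.of_forall fun x => ENNReal.ofReal_lt_top)]
  have hb : 0 < ((1 / 2 : ℂ)).re := by norm_num
  have h := GaussianFourier.integral_cexp_neg_mul_sq_norm_add hb Complex.I t
  have e : ∀ x : EuclideanSpace ℝ (Fin d),
      (ENNReal.ofReal (Real.exp (-(1 / 2) * ‖x‖ ^ 2))).toReal •
        Complex.exp (((inner ℝ x t : ℝ) : ℂ) * Complex.I) =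
      Complex.exp (-(1 / 2) * (‖x‖ : ℂ) ^ 2 + Complex.I * ((inner ℝ t x : ℝ) : ℂ)) := by
    intro x
    rw [ENNReal.toReal_ofReal (Real.exp_pos _).le, Complex.real_smul, Complex.ofReal_exp,
      ← Complex.exp_add, real_inner_comm, mul_comm Complex.I]
    push_cast
    rfl
  simp only [e]
  rw [h, finrank_euclideanSpace_fin, gaussianConst, ENNReal.toReal_ofReal (by positivity)]
  have hpos : (0 : ℝ) < (2 * Real.pi) ^ (d / 2 : ℝ) := by positivity
  have e2 : ((Real.pi : ℂ) / (1 / 2)) ^ ((d : ℂ) / 2) =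
      (((2 * Real.pi) ^ (d / 2 : ℝ) : ℝ) : ℂ) := by
    rw [Complex.ofReal_cpow (by positivity)]
    push_cast
    congr 1
    ring
  rw [e2, Complex.real_smul, ← mul_assoc, ← Complex.ofReal_mul, inv_mul_cancel₀ hpos.ne',
    Complex.ofReal_one, one_mul, Complex.I_sq]
  congr 1
  ring

theorem stdGaussian_apply {B : Set (EuclideanSpace ℝ (Fin d))} (hB : MeasurableSet B) :
    stdGaussian (EuclideanSpace ℝ (Fin d)) B =
      gaussianConst d * ∫⁻ x in B, ENNReal.ofReal (Real.exp (-(1 / 2) * ‖x‖ ^ 2)) := by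
  rw [stdGaussian_eq_withDensity, Measure.smul_apply, withDensity_apply _ hB, smul_eq_mul]

/-- Translation invariance of Lebesgue measure; this is how the shifted cone `T - g` enters the
limit. -/
theorem gaussianConst_mul_setLIntegral {B : Set (EuclideanSpace ℝ (Fin d))}
    (hB : MeasurableSet B) (g : EuclideanSpace ℝ (Fin d)) :
    gaussianConst d * ∫⁻ x in B, ENNReal.ofReal (Real.exp (-(1 / 2) * ‖g - x‖ ^ 2)) =
      stdGaussian (EuclideanSpace ℝ (Fin d)) {x | x + g ∈ B} := by
  have hB' : MeasurableSet {x | x + g ∈ B} := hB.preimage (measurable_add_const g)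
  rw [stdGaussian_apply hB', ← lintegral_indicator hB, ← lintegral_indicator hB',
    ← lintegral_add_right_eq_self _ g]
  congr 2
  ext x
  simp only [indicator, mem_ofPred_eq]
  rw [norm_sub_rev, add_sub_cancel_right]

theorem absolutelyContinuous_stdGaussian :
    stdGaussian (EuclideanSpace ℝ (Fin d)) ≪ volume := by
  rw [stdGaussian_eq_withDensity]
  exact (withDensity_absolutelyContinuous _ _).smul_left _

theorem stdGaussian_pos {B : Set (EuclideanSpace ℝ (Fin d))} (hB : MeasurableSet B)
    (hpos : 0 < volume B) : 0 < stdGaussian (EuclideanSpace ℝ (Fin d)) B := by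
  rw [stdGaussian_apply hB]
  refine ENNReal.mul_pos gaussianConst_ne_zero (ne_of_gt ?_)
  rw [setLIntegral_pos_iff (by fun_prop)]
  have : Function.support (fun x : EuclideanSpace ℝ (Fin d) =>
      ENNReal.ofReal (Real.exp (-(1 / 2) * ‖x‖ ^ 2))) = univ := by
    ext x
    simp [Real.exp_pos]
  rwa [this, univ_inter]

theorem gaussianConst_le_one : gaussianConst d ≤ 1 := by
  rw [gaussianConst, ENNReal.ofReal_le_one]
  refine inv_le_one_of_one_le₀ (Real.one_le_rpow ?_ (by positivity))
  linarith [Real.two_le_pi]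

/-- Constant and kernel are both at most `1`. The bound is free of `g`, so sets of small volume are
negligible uniformly over centers. -/
theorem gaussianConst_mul_setLIntegral_le_volume (B : Set (EuclideanSpace ℝ (Fin d)))
    (g : EuclideanSpace ℝ (Fin d)) :
    gaussianConst d * ∫⁻ x in B, ENNReal.ofReal (Real.exp (-(1 / 2) * ‖g - x‖ ^ 2)) ≤
      volume B := by
  refine (mul_le_of_le_one_left (zero_le) gaussianConst_le_one).trans ?_
  refine (lintegral_mono (g := fun _ => 1) fun x => ?_).trans (by simp)
  rw [ENNReal.ofReal_le_one, Real.exp_le_one_iff]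
  nlinarith [sq_nonneg ‖g - x‖]

theorem chiSqCDF_eq (z : ℝ) :
    chiSqCDF d z = (stdGaussian (EuclideanSpace ℝ (Fin d))).real {x | ‖x‖ ^ 2 ≤ z} := by
  rw [chiSqCDF, ← map_pi_eq_stdGaussian, map_measureReal_apply (by fun_prop)
    (isClosed_le (by fun_prop) continuous_const).measurableSet]
  congr 1
  ext x
  simp [EuclideanSpace.real_norm_sq_eq]

/-- `T ⊆ T - v` for `v ∈ T`, which bounds the conditioning probability away from `0` uniformly in
`v`. -/
theorem stdGaussian_le_add_mem (T : ProperCone ℝ (EuclideanSpace ℝ (Fin d)))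
    {v : EuclideanSpace ℝ (Fin d)} (hv : v ∈ T) :
    stdGaussian (EuclideanSpace ℝ (Fin d)) T ≤
      stdGaussian (EuclideanSpace ℝ (Fin d)) {x | x + v ∈ T} :=
  measure_mono fun _ hx => T.add_mem hx hv

end GaussianDensity

/-! ### Uniform modulus of continuity for the law of `‖Z‖²` -/

section Modulus

/-- A distribution function without jumps is uniformly continuous. -/
theorem uniformContinuous_cdf (ν : Measure ℝ) [IsProbabilityMeasure ν]
    (hν : ∀ x, ν {x} = 0) : UniformContinuous (cdf ν) := by
  have hc : Continuous (cdf ν) := by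
    refine continuous_iff_continuousAt.2 fun x => ?_
    rw [(monotone_cdf ν).continuousAt_iff_leftLim_eq_rightLim]
    have h1 := hν x
    rw [← measure_cdf ν, StieltjesFunction.measure_singleton, ENNReal.ofReal_eq_zero] at h1
    rw [StieltjesFunction.rightLim_eq]
    exact le_antisymm ((monotone_cdf ν).leftLim_le le_rfl) (by linarith)
  -- The clipped identity has the same limits at `±∞` as the distribution function, so the
  -- difference vanishes at infinity and is uniformly continuous.
  let G : ℝ → ℝ := fun x => max 0 (min 1 x)
  have hG : UniformContinuous G :=
    ((LipschitzWith.id (α := ℝ)).const_min 1 |>.const_max 0).uniformContinuous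
  have hdiff : UniformContinuous fun x => cdf ν x - G x := by
    refine (hc.sub hG.continuous).uniformContinuous_of_tendsto_cocompact (x := 0) ?_
    rw [cocompact_eq_atBot_atTop]
    refine Tendsto.sup ?_ ?_
    · have h2 : Tendsto G atBot (𝓝 0) := by
        refine tendsto_const_nhds.congr' ?_
        filter_upwards [eventually_le_atBot 0] with x hx
        simp [G, hx]
      simpa using (tendsto_cdf_atBot ν).sub h2
    · have h2 : Tendsto G atTop (𝓝 1) := by
        refine tendsto_const_nhds.congr' ?_
        filter_upwards [eventually_ge_atTop 1] with x hx
        simp [G, hx]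
      simpa using (tendsto_cdf_atTop ν).sub h2
  simpa using hdiff.add hG

/-- Spheres are Lebesgue null, so `‖Z‖²` has no atoms; `d ≥ 1` is what rules out an atom at `0`.
Here `κ` does not depend on `z`. -/
theorem exists_stdGaussian_norm_sq_Ioc_le {d : ℕ} (hd : 1 ≤ d) {ε : ℝ} (hε : 0 < ε) :
    ∃ κ > 0, ∀ z z' : ℝ, z' ≤ z + κ →
      (stdGaussian (EuclideanSpace ℝ (Fin d))).real {x | z < ‖x‖ ^ 2 ∧ ‖x‖ ^ 2 ≤ z'} ≤ ε := by
  set μ := stdGaussian (EuclideanSpace ℝ (Fin d))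
  have : Nontrivial (EuclideanSpace ℝ (Fin d)) := by
    have : Nonempty (Fin d) := ⟨⟨0, hd⟩⟩
    infer_instance
  have hm : Measurable fun x : EuclideanSpace ℝ (Fin d) => ‖x‖ ^ 2 := by fun_prop
  let ν := μ.map fun x => ‖x‖ ^ 2
  have : IsProbabilityMeasure ν := Measure.isProbabilityMeasure_map hm.aemeasurable
  have hν : ∀ r, ν {r} = 0 := by
    intro r
    rw [Measure.map_apply hm (measurableSet_singleton r)]
    refine measure_mono_null ?_
      (absolutelyContinuous_stdGaussian (Measure.addHaar_sphere volume 0 (√r)))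
    rintro x rfl
    simp
  obtain ⟨κ, hκ, h⟩ := Metric.uniformContinuous_iff.1 (uniformContinuous_cdf ν hν) ε hε
  refine ⟨κ / 2, by positivity, fun z z' hz => ?_⟩
  rcases lt_or_ge z' z with hzz | hzz
  · rw [show {x : EuclideanSpace ℝ (Fin d) | z < ‖x‖ ^ 2 ∧ ‖x‖ ^ 2 ≤ z'} = ∅ from ?_]
    · simpa using hε.le
    · ext x
      simp only [mem_ofPred_eq, mem_empty_iff_false, iff_false, not_and]
      intro h1 h2
      linarith
  have h1 := h (a := z') (b := z) (by
    rw [Real.dist_eq, abs_of_nonneg (by linarith)]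
    linarith)
  have h2 : μ.real {x | z < ‖x‖ ^ 2 ∧ ‖x‖ ^ 2 ≤ z'} = cdf ν z' - cdf ν z := by
    rw [cdf_eq_real, cdf_eq_real, ← measureReal_sdiff (Iic_subset_Iic.2 hzz) measurableSet_Iic,
      map_measureReal_apply hm (measurableSet_Iic.diff measurableSet_Iic)]
    congr 1
    ext x
    simp [and_comm]
  rw [h2]
  exact (le_abs_self _).trans h1.le

end Modulus

end QLRPosterior

namespace QLRPosterior

/-! ### Exhaustion of the cone by convex sets -/

section Cover

variable {d : ℕ}

/-- The interiors of an increasing sequence of convex sets exhaust the closure of their union, up to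
sets of small Lebesgue measure. -/
theorem tendsto_volume_sdiff_interior {C : ℕ → Set (EuclideanSpace ℝ (Fin d))}
    {T : Set (EuclideanSpace ℝ (Fin d))} (hconv : ∀ n ≥ 1, Convex ℝ (C n))
    (hmono : ∀ n ≥ 1, ∀ m ≥ n, C n ⊆ C m) (hT : T = closure (⋃ n ≥ 1, C n)) (R : ℝ) :
    Tendsto (fun n => volume ((T ∩ Metric.closedBall 0 R) \ interior (C n))) atTop (𝓝 0) := by
  rw [← tendsto_add_atTop_iff_nat 1]
  let D : ℕ → Set (EuclideanSpace ℝ (Fin d)) := fun n => C (n + 1)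
  have hD : Monotone D := fun n m h => hmono _ (by omega) _ (by omega)
  have hDc : ∀ n, Convex ℝ (D n) := fun n => hconv _ (by omega)
  have hU : (⋃ n ≥ 1, C n) = ⋃ n, D n := by
    ext x
    simp only [mem_iUnion, D]
    constructor
    · rintro ⟨n, hn, hx⟩
      exact ⟨n - 1, by rwa [Nat.sub_add_cancel hn]⟩
    · rintro ⟨n, hx⟩
      exact ⟨n + 1, by omega, hx⟩
  have hTm : MeasurableSet T := hT ▸ isClosed_closure.measurableSet
  have h := tendsto_measure_iInter_atTop (μ := volume)
    (s := fun n => (T ∩ Metric.closedBall 0 R) \ interior (D n))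
    (fun n => ((hTm.inter Metric.isClosed_closedBall.measurableSet).diff
      isOpen_interior.measurableSet).nullMeasurableSet)
    (fun n m h => sdiff_subset_sdiff_right (interior_mono (hD h)))
    ⟨0, ne_top_of_le_ne_top (measure_closedBall_lt_top (μ := volume)).ne
      (measure_mono (sdiff_subset.trans inter_subset_right))⟩
  have hzero : volume (⋂ n, (T ∩ Metric.closedBall 0 R) \ interior (D n)) = 0 := by
    -- A point of `T` outside every interior lies on the frontier of the union, or in some `D n` and
    -- hence on its frontier. Frontiers of convex sets are null.
    have hsub : (⋂ n, (T ∩ Metric.closedBall 0 R) \ interior (D n)) ⊆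
        frontier (⋃ n, D n) ∪ ⋃ n, frontier (D n) := by
      intro x hx
      rw [mem_iInter] at hx
      have hxT : x ∈ closure (⋃ n, D n) := by
        rw [← hU, ← hT]
        exact (hx 0).1.1
      by_cases hxi : x ∈ interior (⋃ n, D n)
      · obtain ⟨n, hn⟩ := mem_iUnion.1 (interior_subset hxi)
        exact Or.inr (mem_iUnion.2 ⟨n, subset_closure hn, (hx n).2⟩)
      · exact Or.inl ⟨hxT, hxi⟩
    refine measure_mono_null hsub (measure_union_null ?_ (measure_iUnion_null fun n => ?_))
    · exact (hD.directed_le.convex_iUnion fun n => hDc n).addHaar_frontier volume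
    · exact (hDc n).addHaar_frontier volume
  rw [hzero] at h
  exact h

theorem lintegral_comp_smul_euclidean {s : ℝ} (hs : s ≠ 0)
    {G : EuclideanSpace ℝ (Fin d) → ℝ≥0∞} (hG : Measurable G) :
    ∫⁻ y, G (s • y) = ENNReal.ofReal |(s ^ d)⁻¹| * ∫⁻ x, G x := by
  rw [← lintegral_map hG (measurable_const_smul s), Measure.map_addHaar_smul _ hs,
    lintegral_smul_measure, finrank_euclideanSpace_fin, smul_eq_mul]

theorem eventually_forall_norm_lt {ι Θ : Type*} {Θo : ι → Set Θ} {l : Filter ι}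
    {γ : Θ → EuclideanSpace ℝ (Fin d)}
    (hγ_small : Tendsto (fun n => ⨆ θ ∈ Θo n, ‖γ θ‖ₑ) l (𝓝 0)) {r : ℝ} (hr : 0 < r) :
    ∀ᶠ n in l, ∀ θ ∈ Θo n, ‖γ θ‖ < r := by
  filter_upwards [hγ_small.eventually_lt_const (ENNReal.ofReal_pos.2 hr)] with n hn θ hθ
  have h := (le_iSup₂ (f := fun θ (_ : θ ∈ Θo n) => ‖γ θ‖ₑ) θ hθ).trans_lt hn
  rwa [← ofReal_norm, ENNReal.ofReal_lt_ofReal_iff hr] at h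

end Cover

/-! ### Prior mass at the scale `n^{-1/2}` -/

section LocalPrior

variable {Θ : Type*} [MeasurableSpace Θ] {d : ℕ}

/-- Change of variables along `γ`; the indicator is needed because the pushforward is known to have
a density only on `D`. -/
theorem setLIntegral_indicator_comp_eq {prior : Measure Θ} {N : Set Θ}
    {γ : Θ → EuclideanSpace ℝ (Fin d)} (hγ : AEMeasurable γ (prior.restrict N))
    {D : Set (EuclideanSpace ℝ (Fin d))} (hD : MeasurableSet D)
    {dens : EuclideanSpace ℝ (Fin d) → ℝ} (hdens_cont : ContinuousOn dens D)
    (hdens : ((prior.restrict N).map γ).restrict D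
      = (volume.restrict D).withDensity fun g => ENNReal.ofReal (dens g))
    {G : EuclideanSpace ℝ (Fin d) → ℝ≥0∞} (hG : Measurable G) :
    ∫⁻ θ in N, D.indicator G (γ θ) ∂prior = ∫⁻ y in D, ENNReal.ofReal (dens y) * G y := by
  rw [← lintegral_map' (hG.indicator hD).aemeasurable hγ, lintegral_indicator hD, hdens,
    lintegral_withDensity_eq_lintegral_mul₀ (hdens_cont.aemeasurable hD).ennreal_ofReal
      hG.aemeasurable]
  rfl

/-- The scale `dens(0) n^(-d/2)` of the prior mass of local neighborhoods. -/
noncomputable def localScale (d : ℕ) (c : ℝ) (n : ℕ) : ℝ≥0∞ :=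
  ENNReal.ofReal c * ENNReal.ofReal |((√(n : ℝ)) ^ d)⁻¹|

theorem localScale_ne_zero {c : ℝ} (hc : 0 < c) {n : ℕ} (hn : 1 ≤ n) : localScale d c n ≠ 0 := by
  have : 0 < √(n : ℝ) := Real.sqrt_pos.2 (by exact_mod_cast hn)
  refine mul_ne_zero (ENNReal.ofReal_pos.2 hc).ne' (ENNReal.ofReal_pos.2 ?_).ne'
  positivity

theorem localScale_ne_top {c : ℝ} {n : ℕ} : localScale d c n ≠ ∞ :=
  ENNReal.mul_ne_top ENNReal.ofReal_ne_top ENNReal.ofReal_ne_top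

variable {prior : Measure Θ} {Θo : ℕ → Set Θ} {N : Set Θ}
  {γ : Θ → EuclideanSpace ℝ (Fin d)} {Γ : Set (EuclideanSpace ℝ (Fin d))}
  {T : Set (EuclideanSpace ℝ (Fin d))} {k : ℕ → ℝ} {δ : ℝ}
  {dens : EuclideanSpace ℝ (Fin d) → ℝ}

theorem exists_dens_near (hδ : 0 < δ) (h0 : (0 : EuclideanSpace ℝ (Fin d)) ∈ Γ)
    (hdens_cont : ContinuousOn dens (Metric.ball 0 δ ∩ Γ))
    (hdens_pos : ∀ g ∈ Metric.ball 0 δ ∩ Γ, 0 < dens g) {η : ℝ} (hη : 0 < η) :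
    ∃ r > 0, r ≤ δ ∧ ∀ y ∈ Γ, ‖y‖ < r →
      (1 - η) * dens 0 ≤ dens y ∧ dens y ≤ (1 + η) * dens 0 := by
  have h0' : (0 : EuclideanSpace ℝ (Fin d)) ∈ Metric.ball 0 δ ∩ Γ :=
    ⟨Metric.mem_ball_self hδ, h0⟩
  have hpos := hdens_pos 0 h0'
  obtain ⟨r, hr, h⟩ := Metric.continuousWithinAt_iff.1 (hdens_cont 0 h0') (η * dens 0)
    (by positivity)
  refine ⟨min r δ, lt_min hr hδ, min_le_right _ _, fun y hy hyr => ?_⟩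
  have h1 := h (x := y) ⟨by simpa using hyr.trans_le (min_le_right _ _), hy⟩
    (by simpa using hyr.trans_le (min_le_left _ _))
  rw [Real.dist_eq, abs_lt] at h1
  constructor <;> linarith [h1.1, h1.2]

/-- Upper bound for prior integrals over the local neighborhoods. -/
theorem eventually_setLIntegral_le
    (hΘo_meas : ∀ n, MeasurableSet (Θo n))
    (hΘoN : ∀ᶠ n in atTop, Θo n ⊆ N) (hγ : AEMeasurable γ (prior.restrict N)) (hΓ_meas : MeasurableSet Γ)
    (hγΓ : ∀ θ ∈ N, γ θ ∈ Γ) (hT : IsClosed T) (hk : Tendsto k atTop atTop)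
    (hCT : ∀ n : ℕ, 1 ≤ n → (fun θ => √(n : ℝ) • γ θ) '' Θo n ∩ Metric.closedBall 0 (k n) ⊆ T)
    (hγ_small : Tendsto (fun n => ⨆ θ ∈ Θo n, ‖γ θ‖ₑ) atTop (𝓝 0))
    (hδ : 0 < δ) (h0 : (0 : EuclideanSpace ℝ (Fin d)) ∈ Γ)
    (hdens_cont : ContinuousOn dens (Metric.ball 0 δ ∩ Γ))
    (hdens_pos : ∀ g ∈ Metric.ball 0 δ ∩ Γ, 0 < dens g)
    (hdens : ((prior.restrict N).map γ).restrict (Metric.ball 0 δ ∩ Γ)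
      = (volume.restrict (Metric.ball 0 δ ∩ Γ)).withDensity fun g => ENNReal.ofReal (dens g))
    {η : ℝ} (hη : 0 < η) (R : ℝ) :
    ∀ᶠ n : ℕ in atTop, ∀ F : EuclideanSpace ℝ (Fin d) → ℝ≥0∞, Measurable F →
      ∫⁻ θ in Θo n, F (√(n : ℝ) • γ θ) ∂prior ≤
        ENNReal.ofReal (1 + η) * localScale d (dens 0) n *
          ∫⁻ x in T ∪ (Metric.closedBall 0 R)ᶜ, F x := by
  obtain ⟨r, hr, hrδ, hdr⟩ := exists_dens_near hδ h0 hdens_cont hdens_pos hη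
  filter_upwards [hΘoN, eventually_forall_norm_lt hγ_small hr, hk.eventually_ge_atTop R,
    eventually_ge_atTop 1] with n hnN hnr hkn hn F hF
  set s := √(n : ℝ)
  have hs : 0 < s := Real.sqrt_pos.2 (by exact_mod_cast hn)
  -- Rescaled parameters of norm at most `R ≤ k n` lie in `T`. Nothing is known about those farther
  -- out, so all of the complement of the ball is admitted.
  set U := T ∪ (Metric.closedBall (0 : EuclideanSpace ℝ (Fin d)) R)ᶜ with hUdef
  have hU : MeasurableSet U :=
    hT.measurableSet.union Metric.isClosed_closedBall.measurableSet.compl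
  have hD : MeasurableSet (Metric.ball (0 : EuclideanSpace ℝ (Fin d)) δ ∩ Γ) :=
    measurableSet_ball.inter hΓ_meas
  have hUF : Measurable (U.indicator F) := hF.indicator hU
  have hsm : Measurable fun y : EuclideanSpace ℝ (Fin d) => s • y := measurable_const_smul s
  let G : EuclideanSpace ℝ (Fin d) → ℝ≥0∞ :=
    (Metric.ball 0 r).indicator fun y => U.indicator F (s • y)
  have hG : Measurable G := (hUF.comp hsm).indicator measurableSet_ball
  calc ∫⁻ θ in Θo n, F (s • γ θ) ∂prior
      ≤ ∫⁻ θ in Θo n, (Metric.ball 0 δ ∩ Γ).indicator G (γ θ) ∂prior := by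
        refine setLIntegral_mono' (hΘo_meas n) fun θ hθ => ?_
        have h1 : γ θ ∈ Metric.ball 0 r := by simpa using hnr θ hθ
        have h2 : s • γ θ ∈ U := by
          by_cases hb : s • γ θ ∈ Metric.closedBall (0 : EuclideanSpace ℝ (Fin d)) R
          · exact Or.inl (hCT n hn ⟨⟨θ, hθ, rfl⟩, Metric.closedBall_subset_closedBall hkn hb⟩)
          · exact Or.inr hb
        have h3 : γ θ ∈ Metric.ball 0 δ ∩ Γ :=
          ⟨Metric.ball_subset_ball hrδ h1, hγΓ θ (hnN hθ)⟩
        simp only [G]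
        rw [indicator_of_mem h3, indicator_of_mem h1, indicator_of_mem h2]
    _ ≤ ∫⁻ θ in N, (Metric.ball 0 δ ∩ Γ).indicator G (γ θ) ∂prior :=
        lintegral_mono_set hnN
    _ = ∫⁻ y in Metric.ball 0 δ ∩ Γ, ENNReal.ofReal (dens y) * G y :=
        setLIntegral_indicator_comp_eq hγ hD hdens_cont hdens hG
    _ ≤ ∫⁻ y in Metric.ball 0 δ ∩ Γ,
          ENNReal.ofReal ((1 + η) * dens 0) * U.indicator F (s • y) := by
        refine setLIntegral_mono ((hUF.comp hsm).const_mul _) fun y hy => ?_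
        by_cases hyr : y ∈ Metric.ball (0 : EuclideanSpace ℝ (Fin d)) r
        · simp only [G]
          rw [indicator_of_mem hyr]
          gcongr
          exact (hdr y hy.2 (by simpa using hyr)).2
        · simp [G, indicator_of_notMem hyr]
    _ ≤ ∫⁻ y, ENNReal.ofReal ((1 + η) * dens 0) * U.indicator F (s • y) :=
        setLIntegral_le_lintegral _ _
    _ = ENNReal.ofReal (1 + η) * localScale d (dens 0) n * ∫⁻ x in U, F x := by
        rw [lintegral_const_mul (f := fun y => U.indicator F (s • y)) _ (hUF.comp hsm),
          lintegral_comp_smul_euclidean hs.ne' hUF, lintegral_indicator hU,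
          ENNReal.ofReal_mul (by positivity), localScale]
        ring

/-- Lower bound for prior integrals over the local neighborhoods. -/
theorem eventually_le_setLIntegral
    (hΘo_meas : ∀ n, MeasurableSet (Θo n)) (hN_meas : MeasurableSet N)
    (hΘoN : ∀ᶠ n in atTop, Θo n ⊆ N) (hγ : AEMeasurable γ (prior.restrict N)) (hΓ_meas : MeasurableSet Γ)
    (hγΓ : ∀ θ ∈ N, γ θ ∈ Γ)
    (hsat : ∀ M : ℝ, ∀ᶠ n : ℕ in atTop, ∀ᵐ θ ∂prior,
      θ ∈ N → √(n : ℝ) * ‖γ θ‖ ≤ M → γ θ ∈ γ '' Θo n → θ ∈ Θo n)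
    (hγ_small : Tendsto (fun n => ⨆ θ ∈ Θo n, ‖γ θ‖ₑ) atTop (𝓝 0))
    (hδ : 0 < δ) (h0 : (0 : EuclideanSpace ℝ (Fin d)) ∈ Γ)
    (hdens_cont : ContinuousOn dens (Metric.ball 0 δ ∩ Γ))
    (hdens_pos : ∀ g ∈ Metric.ball 0 δ ∩ Γ, 0 < dens g)
    (hdens : ((prior.restrict N).map γ).restrict (Metric.ball 0 δ ∩ Γ)
      = (volume.restrict (Metric.ball 0 δ ∩ Γ)).withDensity fun g => ENNReal.ofReal (dens g))
    {η : ℝ} (hη : 0 < η) (hη1 : η ≤ 1) (R : ℝ) :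
    ∀ᶠ n : ℕ in atTop, ∀ F : EuclideanSpace ℝ (Fin d) → ℝ≥0∞, Measurable F →
      ENNReal.ofReal (1 - η) * localScale d (dens 0) n *
          ∫⁻ x in interior ((fun θ => √(n : ℝ) • γ θ) '' Θo n ∩ Metric.closedBall 0 (k n)) ∩
            Metric.closedBall 0 R, F x ≤
        ∫⁻ θ in Θo n, F (√(n : ℝ) • γ θ) ∂prior := by
  obtain ⟨r, hr, hrδ, hdr⟩ := exists_dens_near hδ h0 hdens_cont hdens_pos hη
  filter_upwards [hΘoN, eventually_forall_norm_lt hγ_small hr, hsat R,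
    eventually_ge_atTop 1] with n hnN hnr hsatn hn F hF
  set s := √(n : ℝ)
  have hs : 0 < s := Real.sqrt_pos.2 (by exact_mod_cast hn)
  -- The interior is used because it is measurable whatever the image of `Θo n` is.
  set U := interior ((fun θ => s • γ θ) '' Θo n ∩ Metric.closedBall 0 (k n)) ∩
    Metric.closedBall 0 R with hUdef
  have hU : MeasurableSet U :=
    isOpen_interior.measurableSet.inter Metric.isClosed_closedBall.measurableSet
  have hD : MeasurableSet (Metric.ball (0 : EuclideanSpace ℝ (Fin d)) δ ∩ Γ) :=
    measurableSet_ball.inter hΓ_meas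
  have hUF : Measurable (U.indicator F) := hF.indicator hU
  have hsm : Measurable fun y : EuclideanSpace ℝ (Fin d) => s • y := measurable_const_smul s
  let G : EuclideanSpace ℝ (Fin d) → ℝ≥0∞ := fun y => U.indicator F (s • y)
  have hG : Measurable G := hUF.comp hsm
  have himage : ∀ y, s • y ∈ U → y ∈ γ '' Θo n := by
    intro y hy
    obtain ⟨θ, hθ, h⟩ := (interior_subset hy.1).1
    exact ⟨θ, hθ, smul_right_injective _ hs.ne' h⟩
  calc ENNReal.ofReal (1 - η) * localScale d (dens 0) n * ∫⁻ x in U, F x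
      = ∫⁻ y, ENNReal.ofReal ((1 - η) * dens 0) * G y := by
        rw [lintegral_const_mul _ hG, lintegral_comp_smul_euclidean hs.ne' hUF,
          lintegral_indicator hU, ENNReal.ofReal_mul (by linarith), localScale]
        ring
    _ ≤ ∫⁻ y, (Metric.ball 0 δ ∩ Γ).indicator (fun y => ENNReal.ofReal (dens y) * G y) y := by
        refine lintegral_mono fun y => ?_
        by_cases hy : s • y ∈ U
        · obtain ⟨θ, hθ, rfl⟩ := himage y hy
          have h1 := hnr θ hθ
          have h2 := hγΓ θ (hnN hθ)
          have h3 : γ θ ∈ Metric.ball 0 δ ∩ Γ := ⟨by simpa using h1.trans_le hrδ, h2⟩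
          rw [indicator_of_mem h3]
          gcongr
          exact (hdr _ h2 h1).1
        · simp [G, indicator_of_notMem hy]
    _ = ∫⁻ θ in N, (Metric.ball 0 δ ∩ Γ).indicator G (γ θ) ∂prior := by
        rw [lintegral_indicator hD, setLIntegral_indicator_comp_eq hγ hD hdens_cont hdens hG]
    _ ≤ ∫⁻ θ in Θo n, F (s • γ θ) ∂prior := by
        rw [← lintegral_indicator hN_meas, ← lintegral_indicator (hΘo_meas n)]
        refine lintegral_mono_ae ?_
        -- The pushforward sees every `θ ∈ N` whose value `γ θ` is attained on `Θo n`; saturation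
        -- puts almost every such `θ` in `Θo n` itself.
        filter_upwards [hsatn] with θ hθ
        by_cases hN : θ ∈ N
        · by_cases hU' : s • γ θ ∈ U
          · have hθo : θ ∈ Θo n := by
              refine hθ hN ?_ (himage _ hU')
              have := hU'.2
              rwa [mem_closedBall_zero_iff, norm_smul, Real.norm_of_nonneg hs.le] at this
            rw [indicator_of_mem hN, indicator_of_mem hθo]
            refine (indicator_le_self _ _ _).trans ?_
            simp [G, indicator_of_mem hU']
          · have : (Metric.ball 0 δ ∩ Γ).indicator G (γ θ) = 0 := by
              simp [G, indicator_of_notMem hU']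
            rw [indicator_of_mem hN, this]
            exact zero_le
        · rw [indicator_of_notMem hN]
          exact zero_le

/-- The prior mass near the identified set, weighted by the Gaussian likelihood centered at `g`, is
asymptotically the Gaussian mass of the translated cone, uniformly over bounded `g`. -/
theorem eventually_local_gaussian
    (hΘo_meas : ∀ n, MeasurableSet (Θo n)) (hN_meas : MeasurableSet N)
    (hΘoN : ∀ᶠ n in atTop, Θo n ⊆ N) (hγ : AEMeasurable γ (prior.restrict N)) (hΓ_meas : MeasurableSet Γ)
    (hγΓ : ∀ θ ∈ N, γ θ ∈ Γ)
    (hsat : ∀ M : ℝ, ∀ᶠ n : ℕ in atTop, ∀ᵐ θ ∂prior,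
      θ ∈ N → √(n : ℝ) * ‖γ θ‖ ≤ M → γ θ ∈ γ '' Θo n → θ ∈ Θo n)
    (hcover : Covers (fun n : ℕ => (fun θ => √(n : ℝ) • γ θ) '' Θo n) T)
    (hγ_small : Tendsto (fun n => ⨆ θ ∈ Θo n, ‖γ θ‖ₑ) atTop (𝓝 0))
    (hδ : 0 < δ) (h0 : (0 : EuclideanSpace ℝ (Fin d)) ∈ Γ)
    (hdens_cont : ContinuousOn dens (Metric.ball 0 δ ∩ Γ))
    (hdens_pos : ∀ g ∈ Metric.ball 0 δ ∩ Γ, 0 < dens g)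
    (hdens : ((prior.restrict N).map γ).restrict (Metric.ball 0 δ ∩ Γ)
      = (volume.restrict (Metric.ball 0 δ ∩ Γ)).withDensity fun g => ENNReal.ofReal (dens g))
    (M : ℝ) {τ : ℝ} (hτ : 0 < τ) :
    ∀ᶠ n : ℕ in atTop, ∀ g : EuclideanSpace ℝ (Fin d), ‖g‖ ≤ M →
      (∀ B, MeasurableSet B →
        gaussianConst d * ∫⁻ θ in Θo n, B.indicator
            (fun x => ENNReal.ofReal (Real.exp (-(1 / 2) * ‖g - x‖ ^ 2)))
              (√(n : ℝ) • γ θ) ∂prior ≤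
          localScale d (dens 0) n *
            (stdGaussian (EuclideanSpace ℝ (Fin d)) {x | x + g ∈ B ∩ T} + ENNReal.ofReal τ)) ∧
      localScale d (dens 0) n * stdGaussian (EuclideanSpace ℝ (Fin d)) {x | x + g ∈ T} ≤
        gaussianConst d * ∫⁻ θ in Θo n,
            ENNReal.ofReal (Real.exp (-(1 / 2) * ‖g - √(n : ℝ) • γ θ‖ ^ 2)) ∂prior +
          localScale d (dens 0) n * ENNReal.ofReal τ := by
  set μ := stdGaussian (EuclideanSpace ℝ (Fin d)) with hμ
  obtain ⟨-, k, hk, hconv, hmono, hTcl⟩ := hcover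
  have hT : IsClosed T := hTcl ▸ isClosed_closure
  have hCT : ∀ n : ℕ, 1 ≤ n →
      (fun θ => √(n : ℝ) • γ θ) '' Θo n ∩ Metric.closedBall 0 (k n) ⊆ T := by
    intro n hn
    conv_rhs => rw [hTcl]
    exact (subset_iUnion₂ (s := fun (n : ℕ) (_ : n ≥ 1) =>
      (fun θ => √(n : ℝ) • γ θ) '' Θo n ∩ Metric.closedBall 0 (k n)) n hn).trans subset_closure
  -- Each of the two bounds below loses at most three terms of size `η`.
  let η : ℝ := min 1 (τ / 3)
  have hη : 0 < η := lt_min one_pos (by positivity)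
  have hη1 : η ≤ 1 := min_le_left _ _
  have hητ : 3 * η ≤ τ := by linarith [min_le_right 1 (τ / 3)]
  let e := ENNReal.ofReal η
  have he : 0 < e := ENNReal.ofReal_pos.2 hη
  have he1 : e ≤ 1 := ENNReal.ofReal_le_one.2 hη1
  have heτ : e + e + e ≤ ENNReal.ofReal τ := by
    rw [← ENNReal.ofReal_add hη.le hη.le, ← ENNReal.ofReal_add (by positivity) hη.le]
    exact ENNReal.ofReal_le_ofReal (by linarith)
  have h1e : ENNReal.ofReal (1 + η) = 1 + e := by
    rw [ENNReal.ofReal_add zero_le_one hη.le, ENNReal.ofReal_one]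
  have h1me : ENNReal.ofReal (1 - η) + e = 1 := by
    rw [← ENNReal.ofReal_add (by linarith) hη.le, sub_add_cancel, ENNReal.ofReal_one]
  obtain ⟨K, hK⟩ : ∃ K : ℕ, μ (Metric.closedBall 0 (K : ℝ))ᶜ < e := by
    have h := tendsto_measure_iInter_atTop (μ := μ)
      (s := fun K : ℕ => (Metric.closedBall (0 : EuclideanSpace ℝ (Fin d)) (K : ℝ))ᶜ)
      (fun K => Metric.isClosed_closedBall.measurableSet.compl.nullMeasurableSet)
      (fun K L h => compl_subset_compl.2
        (Metric.closedBall_subset_closedBall (Nat.cast_le.2 h)))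
      ⟨0, measure_ne_top _ _⟩
    have hempty : (⋂ K : ℕ, (Metric.closedBall (0 : EuclideanSpace ℝ (Fin d)) (K : ℝ))ᶜ) = ∅ := by
      rw [← compl_iUnion, Metric.iUnion_closedBall_nat, compl_univ]
    rw [hempty, measure_empty] at h
    exact (h.eventually_lt_const he).exists
  -- If `‖x + g‖ > K + M` and `‖g‖ ≤ M` then `‖x‖ > K`, so the tail is small uniformly in `g`.
  set R : ℝ := K + M with hR
  have htail : ∀ g : EuclideanSpace ℝ (Fin d), ‖g‖ ≤ M →
      μ {x | x + g ∈ (Metric.closedBall (0 : EuclideanSpace ℝ (Fin d)) R)ᶜ} ≤ e := by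
    intro g hg
    refine le_trans (measure_mono fun x hx => ?_) hK.le
    simp only [mem_ofPred_eq, mem_compl_iff, mem_closedBall_zero_iff, not_le] at hx ⊢
    linarith [norm_add_le x g]
  have hvol := tendsto_volume_sdiff_interior hconv hmono hTcl R
  filter_upwards [eventually_setLIntegral_le hΘo_meas hΘoN hγ hΓ_meas hγΓ hT hk hCT hγ_small hδ
      h0 hdens_cont hdens_pos hdens hη R,
    eventually_le_setLIntegral (k := k) hΘo_meas hN_meas hΘoN hγ hΓ_meas hγΓ hsat hγ_small hδ h0
      hdens_cont hdens_pos hdens hη hη1 R,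
    hvol.eventually_lt_const he] with n hup hlow hvoln g hg
  set a := localScale d (dens 0) n
  have hfm : Measurable fun x : EuclideanSpace ℝ (Fin d) =>
      ENNReal.ofReal (Real.exp (-(1 / 2) * ‖g - x‖ ^ 2)) := by fun_prop
  constructor
  · intro B hB
    have hU : MeasurableSet (T ∪ (Metric.closedBall (0 : EuclideanSpace ℝ (Fin d)) R)ᶜ) :=
      hT.measurableSet.union Metric.isClosed_closedBall.measurableSet.compl
    have h1 := hup _ (hfm.indicator hB)
    rw [setLIntegral_indicator hB] at h1
    set m := μ {x | x + g ∈ B ∩ T}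
    have hm1 : m ≤ 1 := prob_le_one
    have h2 : gaussianConst d * ∫⁻ x in B ∩ (T ∪ (Metric.closedBall 0 R)ᶜ),
        ENNReal.ofReal (Real.exp (-(1 / 2) * ‖g - x‖ ^ 2)) ≤ m + e := by
      rw [gaussianConst_mul_setLIntegral (hB.inter hU)]
      refine (measure_mono ?_).trans
        ((measure_union_le _ _).trans (add_le_add le_rfl (htail g hg)))
      rintro x ⟨hxB, hxT | hxR⟩
      · exact Or.inl ⟨hxB, hxT⟩
      · exact Or.inr hxR
    calc gaussianConst d * ∫⁻ θ in Θo n, B.indicator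
            (fun x => ENNReal.ofReal (Real.exp (-(1 / 2) * ‖g - x‖ ^ 2)))
              (√(n : ℝ) • γ θ) ∂prior
        ≤ gaussianConst d * (ENNReal.ofReal (1 + η) * a *
            ∫⁻ x in B ∩ (T ∪ (Metric.closedBall 0 R)ᶜ),
              ENNReal.ofReal (Real.exp (-(1 / 2) * ‖g - x‖ ^ 2))) := by gcongr
      _ = (1 + e) * a * (gaussianConst d * ∫⁻ x in B ∩ (T ∪ (Metric.closedBall 0 R)ᶜ),
              ENNReal.ofReal (Real.exp (-(1 / 2) * ‖g - x‖ ^ 2))) := by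
          rw [h1e]
          ring
      _ ≤ (1 + e) * a * (m + e) := by gcongr
      _ = a * (m + (e + e * m + e * e)) := by ring
      _ ≤ a * (m + (e + e * 1 + e * 1)) := by gcongr
      _ ≤ a * (m + ENNReal.ofReal τ) := by
          rw [mul_one]
          gcongr
  · set W := interior ((fun θ => √(n : ℝ) • γ θ) '' Θo n ∩ Metric.closedBall 0 (k n))
    have hW : MeasurableSet (W ∩ Metric.closedBall (0 : EuclideanSpace ℝ (Fin d)) R) :=
      isOpen_interior.measurableSet.inter Metric.isClosed_closedBall.measurableSet
    have hQ : MeasurableSet ((T ∩ Metric.closedBall 0 R) \ W) :=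
      (hT.measurableSet.inter Metric.isClosed_closedBall.measurableSet).diff
        isOpen_interior.measurableSet
    have h1 := hlow _ hfm
    set m := μ {x | x + g ∈ W ∩ Metric.closedBall 0 R} with hm
    have hm1 : m ≤ 1 := prob_le_one
    have h2 : μ {x | x + g ∈ T} ≤ m + (e + e) := by
      have hsub : {x | x + g ∈ T} ⊆ {x | x + g ∈ W ∩ Metric.closedBall 0 R} ∪
          ({x | x + g ∈ (T ∩ Metric.closedBall 0 R) \ W} ∪
            {x | x + g ∈ (Metric.closedBall (0 : EuclideanSpace ℝ (Fin d)) R)ᶜ}) := by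
        intro x hx
        by_cases hxR : x + g ∈ Metric.closedBall (0 : EuclideanSpace ℝ (Fin d)) R
        · by_cases hxW : x + g ∈ W
          · exact Or.inl ⟨hxW, hxR⟩
          · exact Or.inr (Or.inl ⟨⟨hx, hxR⟩, hxW⟩)
        · exact Or.inr (Or.inr hxR)
      refine (measure_mono hsub).trans ((measure_union_le _ _).trans
        (add_le_add le_rfl ((measure_union_le _ _).trans (add_le_add ?_ (htail g hg)))))
      rw [← gaussianConst_mul_setLIntegral hQ]
      exact (gaussianConst_mul_setLIntegral_le_volume _ _).trans hvoln.le
    calc a * μ {x | x + g ∈ T} ≤ a * (m + (e + e)) := by gcongr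
      _ = a * ((ENNReal.ofReal (1 - η) + e) * m + (e + e)) := by rw [h1me, one_mul]
      _ = ENNReal.ofReal (1 - η) * a * m + a * (e * m + e + e) := by ring
      _ ≤ ENNReal.ofReal (1 - η) * a * m + a * (e * 1 + e + e) := by gcongr
      _ ≤ ENNReal.ofReal (1 - η) * a * m + a * ENNReal.ofReal τ := by
          rw [mul_one]
          gcongr
      _ ≤ _ := by
          rw [hm, ← gaussianConst_mul_setLIntegral hW, mul_left_comm]
          gcongr

end LocalPrior

end QLRPosterior

namespace QLRPosterior

/-! ### Passing from extended reals to reals -/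

section ERealFacts

theorem exists_real_of_abs_sub_le {x : EReal} {r ε : ℝ} (hε : 0 ≤ ε)
    (h : (x - (r : EReal)).abs ≤ ENNReal.ofReal ε) : ∃ y : ℝ, x = y ∧ |y - r| ≤ ε := by
  induction x using EReal.rec with
  | bot => simp at h
  | top => simp at h
  | coe y =>
    refine ⟨y, rfl, ?_⟩
    rwa [← EReal.coe_sub, EReal.abs_def, ENNReal.ofReal_le_ofReal_iff hε] at h

/-- `n ≥ 1` matters: `0 * ⊥ = 0` would hide an infinite value. -/
theorem exists_real_of_natCast_mul_eq {n : ℕ} (hn : 1 ≤ n) {x : EReal} {y : ℝ}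
    (h : (n : EReal) * x = y) : ∃ l : ℝ, x = l ∧ n * l = y := by
  have hn' : (0 : ℝ) < n := by exact_mod_cast hn
  rw [← EReal.coe_natCast] at h
  induction x using EReal.rec with
  | bot => exact absurd h (by rw [EReal.coe_mul_bot_of_pos hn']; exact EReal.bot_ne_coe _)
  | top => exact absurd h (by rw [EReal.coe_mul_top_of_pos hn']; exact EReal.top_ne_coe _)
  | coe l => exact ⟨l, rfl, by exact_mod_cast h⟩

theorem exists_reals_of_abs_mul_sub_le {n : ℕ} (hn : 1 ≤ n) {x y : EReal} (hx : x ≠ ⊤) {ε : ℝ}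
    (hε : 0 ≤ ε) (h : ((n : EReal) * (x - y)).abs ≤ ENNReal.ofReal ε) :
    ∃ u v : ℝ, x = u ∧ y = v ∧ |n * u - n * v| ≤ ε := by
  obtain ⟨w, hw, hwε⟩ := exists_real_of_abs_sub_le (r := 0) hε
    (by rwa [EReal.coe_zero, sub_zero])
  obtain ⟨l, hl, hlw⟩ := exists_real_of_natCast_mul_eq hn hw
  induction x using EReal.rec with
  | bot => simp at hl
  | top => exact absurd rfl hx
  | coe u =>
    induction y using EReal.rec with
    | bot => simp at hl
    | top => simp at hl
    | coe v =>
      refine ⟨u, v, rfl, rfl, ?_⟩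
      have : u - v = l := by exact_mod_cast hl
      rw [← mul_sub, this, hlw]
      simpa using hwε

end ERealFacts

/-! ### Expansion of likelihood and QLR statistic -/

section LocalExpansion

variable {Θ : Type*} {d n : ℕ} {Ln : Θ → EReal} {Θo : Set Θ}
  {φ : Θ → EuclideanSpace ℝ (Fin d)} {g : EuclideanSpace ℝ (Fin d)} {c ε : ℝ}

theorem exp_mul_bounds (hε : 0 ≤ ε) {θ : Θ}
    (h : ((n : EReal) * Ln θ - ((c - 1 / 2 * ‖g - φ θ‖ ^ 2 : ℝ) : EReal)).abs
      ≤ ENNReal.ofReal ε) :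
    ENNReal.ofReal (Real.exp (c - ε)) *
        ENNReal.ofReal (Real.exp (-(1 / 2) * ‖g - φ θ‖ ^ 2)) ≤ EReal.exp (n * Ln θ) ∧
      EReal.exp (n * Ln θ) ≤ ENNReal.ofReal (Real.exp (c + ε)) *
        ENNReal.ofReal (Real.exp (-(1 / 2) * ‖g - φ θ‖ ^ 2)) := by
  obtain ⟨y, hy, hyε⟩ := exists_real_of_abs_sub_le hε h
  rw [abs_le] at hyε
  rw [hy, EReal.exp_coe, ← ENNReal.ofReal_mul (Real.exp_pos _).le,
    ← ENNReal.ofReal_mul (Real.exp_pos _).le, ← Real.exp_add, ← Real.exp_add]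
  constructor <;> refine ENNReal.ofReal_le_ofReal (Real.exp_le_exp.2 ?_) <;> linarith [hyε.1, hyε.2]

/-- On the local neighborhood the QLR statistic is close to the squared distance between the reduced
form parameter and its estimator. -/
theorem exists_qlr_eq (hn : 1 ≤ n) {θhat : Θ} (hhat : Ln θhat ≠ ⊤) (hε : 0 ≤ ε)
    (hrate : ((n : EReal) * (Ln θhat - ⨆ θ ∈ Θo, Ln θ)).abs ≤ ENNReal.ofReal ε)
    (hquad : ∀ θ ∈ Θo, ((n : EReal) * Ln θ - ((c - 1 / 2 * ‖g - φ θ‖ ^ 2 : ℝ) : EReal)).abs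
      ≤ ENNReal.ofReal ε) (hnear : ∃ θ ∈ Θo, ‖g - φ θ‖ ^ 2 ≤ 2 * ε) {θ : Θ} (hθ : θ ∈ Θo) :
    ∃ y : ℝ, qlr n Ln θhat θ = y ∧ |y - ‖g - φ θ‖ ^ 2| ≤ 8 * ε := by
  have hn' : (0 : ℝ) < n := by exact_mod_cast hn
  obtain ⟨u, v, hu, hv, huv⟩ := exists_reals_of_abs_mul_sub_le hn hhat hε hrate
  have hreal : ∀ θ ∈ Θo, ∃ l : ℝ, Ln θ = l ∧ |n * l - (c - 1 / 2 * ‖g - φ θ‖ ^ 2)| ≤ ε := by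
    intro θ hθ
    obtain ⟨y, hy, hyε⟩ := exists_real_of_abs_sub_le hε (hquad θ hθ)
    obtain ⟨l, hl, hly⟩ := exists_real_of_natCast_mul_eq hn hy
    exact ⟨l, hl, by rwa [hly]⟩
  have hv_le : n * v ≤ c + ε := by
    have : (v : EReal) ≤ (((c + ε) / n : ℝ) : EReal) := by
      rw [← hv]
      refine iSup₂_le fun θ hθ => ?_
      obtain ⟨l, hl, hlε⟩ := hreal θ hθ
      rw [hl, EReal.coe_le_coe_iff, le_div_iff₀ hn']
      rw [abs_le] at hlε
      nlinarith [sq_nonneg ‖g - φ θ‖]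
    rw [EReal.coe_le_coe_iff, le_div_iff₀ hn'] at this
    linarith
  -- One `ε` is the approximation error, the other is half the squared distance from `g` to the
  -- nearby point.
  have hle_v : c - 2 * ε ≤ n * v := by
    obtain ⟨θ', hθ', hnear'⟩ := hnear
    obtain ⟨l, hl, hlε⟩ := hreal θ' hθ'
    have : (l : EReal) ≤ v := by
      rw [← hl, ← hv]
      exact le_iSup₂ (f := fun θ (_ : θ ∈ Θo) => Ln θ) θ' hθ'
    rw [EReal.coe_le_coe_iff] at this
    rw [abs_le] at hlε
    nlinarith [mul_le_mul_of_nonneg_left this hn'.le]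
  obtain ⟨l, hl, hlε⟩ := hreal θ hθ
  refine ⟨2 * n * (u - l), ?_, ?_⟩
  · rw [qlr, hu, hl]
    norm_cast
  -- `n * u` is within `ε` of `n * v ∈ [c - 2ε, c + ε]`, and `n * l` has error `ε`; doubling the
  -- worst total of `4ε` gives `8ε`.
  · rw [abs_le] at huv hlε ⊢
    constructor <;> linarith [huv.1, huv.2, hlε.1, hlε.2]

/-- With `A = exp (2η) / (1 - η) ≥ 1` the quotient is at most `A (G + 2η)`, and `(A - 1)(G - 1) ≤ 0`
bounds this by `G + A (1 + 2η) - 1`. The excess over `G` is free of `G` and vanishes with `η`. -/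
theorem ratio_bound {ε η J J₀ J' G : ℝ} (hεη : ε ≤ η) (hη : 0 < η) (hη1 : η < 1)
    (hJ₀ : 0 < J₀) (hJ : J₀ ≤ J) (hG : G ≤ 1) (hJ'0 : 0 ≤ J') (hJ' : J' ≤ G * J + η * J₀) :
    ε + Real.exp (2 * ε) * (J' + η * J₀) / (J - η * J₀) ≤
      G + (η + Real.exp (2 * η) * (1 + 2 * η) / (1 - η) - 1) := by
  have hJpos : 0 < J := hJ₀.trans_le hJ
  have hηJ : η * J₀ ≤ η * J := by gcongr
  have h1η : 0 < 1 - η := by linarith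
  have hden : 0 < J * (1 - η) := by positivity
  have h1 : Real.exp (2 * ε) * (J' + η * J₀) / (J - η * J₀) ≤
      Real.exp (2 * η) * (G * J + 2 * (η * J)) / (J * (1 - η)) := by
    have hnum : J' + η * J₀ ≤ G * J + 2 * (η * J) := by linarith
    have hdiv : J * (1 - η) ≤ J - η * J₀ := by linarith
    exact div_le_div₀ (mul_nonneg (Real.exp_pos _).le (by nlinarith [mul_pos hη hJ₀]))
      (mul_le_mul (Real.exp_le_exp.2 (by linarith)) hnum (by positivity) (Real.exp_pos _).le)
      hden hdiv
  have h2 : Real.exp (2 * η) * (G * J + 2 * (η * J)) / (J * (1 - η)) =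
      Real.exp (2 * η) / (1 - η) * (G + 2 * η) := by
    field_simp
  have h3 : 1 ≤ Real.exp (2 * η) / (1 - η) := by
    rw [le_div_iff₀ h1η]
    have := Real.add_one_le_exp (2 * η)
    linarith
  have h4 : Real.exp (2 * η) * (1 + 2 * η) / (1 - η) =
      Real.exp (2 * η) / (1 - η) * (1 + 2 * η) := by ring
  rw [h2] at h1
  rw [h4]
  nlinarith [mul_nonneg (sub_nonneg.2 h3) (sub_nonneg.2 hG)]

end LocalExpansion

/-! ### Bounds on quasi-posterior probabilities -/

section QuasiPosterior

variable {Θ : Type*} [MeasurableSpace Θ] {d : ℕ} {prior : Measure Θ} {n : ℕ} {Ln : Θ → EReal}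

theorem quasiPosterior_apply {S : Set Θ} (hS : MeasurableSet S) :
    quasiPosterior prior n Ln S =
      (∫⁻ θ in S, EReal.exp (n * Ln θ) ∂prior) / ∫⁻ θ, EReal.exp (n * Ln θ) ∂prior := by
  rw [quasiPosterior, Measure.smul_apply, withDensity_apply _ hS, smul_eq_mul, mul_comm,
    div_eq_mul_inv]

theorem isProbabilityMeasure_quasiPosterior (h0 : ∫⁻ θ, EReal.exp (n * Ln θ) ∂prior ≠ 0)
    (hfin : ∫⁻ θ, EReal.exp (n * Ln θ) ∂prior ≠ ∞) :
    IsProbabilityMeasure (quasiPosterior prior n Ln) :=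
  ⟨by rw [quasiPosterior_apply MeasurableSet.univ, setLIntegral_univ,
    ENNReal.div_self h0 hfin]⟩

theorem measurableSet_qlr_le (hLn : Measurable Ln) (θhat : Θ) (z : ℝ) :
    MeasurableSet {θ | qlr n Ln θhat θ ≤ (z : EReal)} := by
  have : Measurable (qlr n Ln θhat) := by
    unfold qlr
    simp only [sub_eq_add_neg]
    exact (measurable_const.add hLn.neg).const_mul _
  exact measurableSet_le this measurable_const

variable {Θo : Set Θ} {φ : Θ → EuclideanSpace ℝ (Fin d)} {g : EuclideanSpace ℝ (Fin d)} {c ε : ℝ}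

/-- Lower bound for the normalizing integral over the local neighborhood. -/
theorem le_setLIntegral_exp_mul (hΘo : MeasurableSet Θo) (hε : 0 ≤ ε)
    (hquad : ∀ θ ∈ Θo, ((n : EReal) * Ln θ - ((c - 1 / 2 * ‖g - φ θ‖ ^ 2 : ℝ) : EReal)).abs
      ≤ ENNReal.ofReal ε) {κ a : ℝ≥0∞} (ha : a ≠ ∞) {J τ : ℝ} (hτ : 0 ≤ τ) (hJ : τ ≤ J)
    (hlow : a * ENNReal.ofReal J ≤
      κ * ∫⁻ θ in Θo, ENNReal.ofReal (Real.exp (-(1 / 2) * ‖g - φ θ‖ ^ 2)) ∂prior +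
        a * ENNReal.ofReal τ) :
    ENNReal.ofReal (Real.exp (c - ε)) * (a * ENNReal.ofReal (J - τ)) ≤
      κ * ∫⁻ θ in Θo, EReal.exp (n * Ln θ) ∂prior := by
  have h1 : a * ENNReal.ofReal (J - τ) ≤
      κ * ∫⁻ θ in Θo, ENNReal.ofReal (Real.exp (-(1 / 2) * ‖g - φ θ‖ ^ 2)) ∂prior := by
    rw [← ENNReal.add_le_add_iff_right (ENNReal.mul_ne_top ha (ENNReal.ofReal_ne_top (r := τ))),
      ← mul_add, ← ENNReal.ofReal_add (by linarith) hτ, sub_add_cancel]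
    exact hlow
  calc ENNReal.ofReal (Real.exp (c - ε)) * (a * ENNReal.ofReal (J - τ))
      ≤ ENNReal.ofReal (Real.exp (c - ε)) * (κ *
          ∫⁻ θ in Θo, ENNReal.ofReal (Real.exp (-(1 / 2) * ‖g - φ θ‖ ^ 2)) ∂prior) := by gcongr
    _ = κ * ∫⁻ θ in Θo, ENNReal.ofReal (Real.exp (c - ε)) *
          ENNReal.ofReal (Real.exp (-(1 / 2) * ‖g - φ θ‖ ^ 2)) ∂prior := by
        rw [lintegral_const_mul' _ _ ENNReal.ofReal_ne_top, mul_left_comm]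
    _ ≤ κ * ∫⁻ θ in Θo, EReal.exp (n * Ln θ) ∂prior := by
        gcongr 1
        exact setLIntegral_mono' hΘo fun θ hθ => (exp_mul_bounds hε (hquad θ hθ)).1

/-- Upper bound for the quasi-posterior probability of a set whose local part is described by the
reduced-form parameter. -/
theorem quasiPosterior_le (hΘo : MeasurableSet Θo) (hε : 0 ≤ ε)
    (hrate : quasiPosterior prior n Ln Θoᶜ ≤ ENNReal.ofReal ε)
    (hquad : ∀ θ ∈ Θo, ((n : EReal) * Ln θ - ((c - 1 / 2 * ‖g - φ θ‖ ^ 2 : ℝ) : EReal)).abs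
      ≤ ENNReal.ofReal ε) {κ a : ℝ≥0∞} (hκ0 : κ ≠ 0) (hκ : κ ≠ ∞) (ha : a ≠ ∞)
    {J J' τ : ℝ} (hτ : 0 ≤ τ) (hJ : τ < J) (hJ' : 0 ≤ J')
    {B : Set (EuclideanSpace ℝ (Fin d))}
    (hup : κ * ∫⁻ θ in Θo, B.indicator
        (fun x => ENNReal.ofReal (Real.exp (-(1 / 2) * ‖g - x‖ ^ 2))) (φ θ) ∂prior ≤
      a * (ENNReal.ofReal J' + ENNReal.ofReal τ))
    (hlow : a * ENNReal.ofReal J ≤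
      κ * ∫⁻ θ in Θo, ENNReal.ofReal (Real.exp (-(1 / 2) * ‖g - φ θ‖ ^ 2)) ∂prior +
        a * ENNReal.ofReal τ)
    {S : Set Θ} (hS : MeasurableSet S) (hSB : ∀ θ ∈ S ∩ Θo, φ θ ∈ B) :
    quasiPosterior prior n Ln S ≤
      ENNReal.ofReal (ε + Real.exp (2 * ε) * (J' + τ) / (J - τ)) := by
  have hJτ : 0 < J - τ := sub_pos.2 hJ
  set q : ℝ := Real.exp (2 * ε) * (J' + τ) / (J - τ) with hq
  have hq0 : 0 ≤ q := by positivity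
  have hlow' := le_setLIntegral_exp_mul hΘo hε hquad ha hτ hJ.le hlow
  have hup' : κ * ∫⁻ θ in S ∩ Θo, EReal.exp (n * Ln θ) ∂prior ≤
      ENNReal.ofReal (Real.exp (c + ε)) * (a * ENNReal.ofReal (J' + τ)) := by
    calc κ * ∫⁻ θ in S ∩ Θo, EReal.exp (n * Ln θ) ∂prior
        ≤ κ * ∫⁻ θ in S ∩ Θo, ENNReal.ofReal (Real.exp (c + ε)) * B.indicator
            (fun x => ENNReal.ofReal (Real.exp (-(1 / 2) * ‖g - x‖ ^ 2))) (φ θ) ∂prior := by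
          gcongr 1
          refine setLIntegral_mono' (hS.inter hΘo) fun θ hθ => ?_
          rw [indicator_of_mem (hSB θ hθ)]
          exact (exp_mul_bounds hε (hquad θ hθ.2)).2
      _ ≤ κ * ∫⁻ θ in Θo, ENNReal.ofReal (Real.exp (c + ε)) * B.indicator
            (fun x => ENNReal.ofReal (Real.exp (-(1 / 2) * ‖g - x‖ ^ 2))) (φ θ) ∂prior := by
          gcongr 1
          exact lintegral_mono_set inter_subset_right
      _ = ENNReal.ofReal (Real.exp (c + ε)) * (κ * ∫⁻ θ in Θo, B.indicator
            (fun x => ENNReal.ofReal (Real.exp (-(1 / 2) * ‖g - x‖ ^ 2))) (φ θ) ∂prior) := by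
          rw [lintegral_const_mul' _ _ ENNReal.ofReal_ne_top, mul_left_comm]
      _ ≤ _ := by
          rw [ENNReal.ofReal_add hJ' hτ]
          gcongr
  -- The unknown centering `c` and the scale `a` cancel between numerator and denominator; only `exp
  -- (2ε)` remains.
  have hfac : ENNReal.ofReal (Real.exp (c + ε)) * (a * ENNReal.ofReal (J' + τ)) =
      ENNReal.ofReal q * (ENNReal.ofReal (Real.exp (c - ε)) * (a * ENNReal.ofReal (J - τ))) := by
    have e : Real.exp (c + ε) * (J' + τ) = q * (Real.exp (c - ε) * (J - τ)) := by
      rw [hq, show c + ε = 2 * ε + (c - ε) by ring, Real.exp_add]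
      field_simp
    calc ENNReal.ofReal (Real.exp (c + ε)) * (a * ENNReal.ofReal (J' + τ))
        = a * ENNReal.ofReal (Real.exp (c + ε) * (J' + τ)) := by
          rw [ENNReal.ofReal_mul (Real.exp_pos _).le]
          ring
      _ = _ := by
          rw [e, ENNReal.ofReal_mul hq0, ENNReal.ofReal_mul (Real.exp_pos _).le]
          ring
  have hratio : ∫⁻ θ in S ∩ Θo, EReal.exp (n * Ln θ) ∂prior ≤
      ENNReal.ofReal q * ∫⁻ θ, EReal.exp (n * Ln θ) ∂prior := by
    rw [← ENNReal.mul_le_mul_iff_right hκ0 hκ]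
    calc κ * ∫⁻ θ in S ∩ Θo, EReal.exp (n * Ln θ) ∂prior
        ≤ ENNReal.ofReal q * (κ * ∫⁻ θ in Θo, EReal.exp (n * Ln θ) ∂prior) := by
          rw [hfac] at hup'
          exact hup'.trans (by gcongr)
      _ ≤ ENNReal.ofReal q * (κ * ∫⁻ θ, EReal.exp (n * Ln θ) ∂prior) := by
          gcongr 2
          exact setLIntegral_le_lintegral _ _
      _ = _ := mul_left_comm _ _ _
  calc quasiPosterior prior n Ln S
      ≤ quasiPosterior prior n Ln Θoᶜ + quasiPosterior prior n Ln (S ∩ Θo) := by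
        refine (measure_mono fun θ hθ => ?_).trans (measure_union_le _ _)
        by_cases h : θ ∈ Θo
        · exact Or.inr ⟨hθ, h⟩
        · exact Or.inl h
    _ ≤ ENNReal.ofReal ε + ENNReal.ofReal q := by
        refine add_le_add hrate ?_
        rw [quasiPosterior_apply (hS.inter hΘo)]
        exact ENNReal.div_le_of_le_mul hratio
    _ = _ := (ENNReal.ofReal_add hε hq0).symm

end QuasiPosterior

/-! ### Deterministic comparison of distribution functions -/

section PosteriorCDF

variable {Θ : Type*} [MeasurableSpace Θ] {d : ℕ} {prior : Measure Θ} {n : ℕ} {Ln : Θ → EReal}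
  {Θo : Set Θ} {φ : Θ → EuclideanSpace ℝ (Fin d)} {g : EuclideanSpace ℝ (Fin d)} {c ε : ℝ}

/-- Deterministic bound for the distance between the posterior distribution function of the QLR
statistic and its Gaussian approximation. -/
theorem abs_postCDF_sub_condNormCDF_le (T : ProperCone ℝ (EuclideanSpace ℝ (Fin d)))
    (hn : 1 ≤ n) (hLn : Measurable Ln) {θhat : Θ} (hhat : Ln θhat ≠ ⊤) (hΘo : MeasurableSet Θo)
    (hgT : g ∈ T) (hε : 0 ≤ ε) {η : ℝ} (hεη : ε ≤ η) (hη : 0 < η) (hη1 : η < 1)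
    (hfin : ∫⁻ θ, EReal.exp (n * Ln θ) ∂prior < ∞)
    (hrate1 : ((n : EReal) * (Ln θhat - ⨆ θ ∈ Θo, Ln θ)).abs ≤ ENNReal.ofReal ε)
    (hrate2 : quasiPosterior prior n Ln Θoᶜ ≤ ENNReal.ofReal ε)
    (hquad : ∀ θ ∈ Θo, ((n : EReal) * Ln θ - ((c - 1 / 2 * ‖g - φ θ‖ ^ 2 : ℝ) : EReal)).abs
      ≤ ENNReal.ofReal ε) (hnear : ∃ θ ∈ Θo, ‖g - φ θ‖ ^ 2 ≤ 2 * ε)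
    {a : ℝ≥0∞} (ha0 : a ≠ 0) (ha : a ≠ ∞) {J₀ : ℝ}
    (hJ₀ : J₀ = (stdGaussian (EuclideanSpace ℝ (Fin d))).real T) (hJ₀pos : 0 < J₀)
    (hup : ∀ B, MeasurableSet B →
      gaussianConst d * ∫⁻ θ in Θo, B.indicator
          (fun x => ENNReal.ofReal (Real.exp (-(1 / 2) * ‖g - x‖ ^ 2))) (φ θ) ∂prior ≤
        a * (stdGaussian (EuclideanSpace ℝ (Fin d)) {x | x + g ∈ B ∩ T} +
          ENNReal.ofReal (η * J₀)))
    (hlow : a * stdGaussian (EuclideanSpace ℝ (Fin d)) {x | x + g ∈ T} ≤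
      gaussianConst d * ∫⁻ θ in Θo,
          ENNReal.ofReal (Real.exp (-(1 / 2) * ‖g - φ θ‖ ^ 2)) ∂prior +
        a * ENNReal.ofReal (η * J₀))
    (hmod : ∀ z z' : ℝ, z' ≤ z + 8 * ε →
      (stdGaussian (EuclideanSpace ℝ (Fin d))).real {x | z < ‖x‖ ^ 2 ∧ ‖x‖ ^ 2 ≤ z'} ≤ η * J₀)
    (z : ℝ) :
    |postCDF prior n Ln θhat z - condNormCDF T g z| ≤
      η + Real.exp (2 * η) * (1 + 2 * η) / (1 - η) - 1 := by
  set μ := stdGaussian (EuclideanSpace ℝ (Fin d)) with hμ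
  set ρ := η + Real.exp (2 * η) * (1 + 2 * η) / (1 - η) - 1
  set J := μ.real {x | x + g ∈ T} with hJdef
  have hTm := measurableSet_add_mem T g
  have hJ : J₀ ≤ J := by
    rw [hJ₀]
    exact ENNReal.toReal_mono (measure_ne_top _ _) (stdGaussian_le_add_mem T hgT)
  have hJpos : 0 < J := hJ₀pos.trans_le hJ
  have hτ : 0 ≤ η * J₀ := by positivity
  have hτJ : η * J₀ < J := by nlinarith
  rw [← ofReal_measureReal, ← hJdef] at hlow
  -- A nonzero normalizer makes the quasi-posterior a probability measure, so lower bounds follow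
  -- from upper bounds on complements.
  have hZ0 : ∫⁻ θ, EReal.exp (n * Ln θ) ∂prior ≠ 0 := by
    intro h0
    have h1 := le_setLIntegral_exp_mul hΘo hε hquad ha hτ hτJ.le hlow
    have h2 : ∫⁻ θ in Θo, EReal.exp (n * Ln θ) ∂prior = 0 :=
      le_antisymm ((setLIntegral_le_lintegral _ _).trans h0.le) (zero_le)
    rw [h2, mul_zero, nonpos_iff_eq_zero] at h1
    refine mul_ne_zero ?_ (mul_ne_zero ha0 ?_) h1
    · exact (ENNReal.ofReal_pos.2 (Real.exp_pos _)).ne'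
    · exact (ENNReal.ofReal_pos.2 (by linarith)).ne'
  have hprob := isProbabilityMeasure_quasiPosterior hZ0 hfin.ne
  set S := {θ | qlr n Ln θhat θ ≤ (z : EReal)} with hSdef
  have hS : MeasurableSet S := measurableSet_qlr_le hLn θhat z
  have hqlr := fun θ (hθ : θ ∈ Θo) => exists_qlr_eq hn hhat hε hrate1 hquad hnear hθ
  have hpost : ∀ (S' : Set Θ) (B : Set (EuclideanSpace ℝ (Fin d))), MeasurableSet S' →
      MeasurableSet B → (∀ θ ∈ S' ∩ Θo, φ θ ∈ B) → ∀ G : ℝ, G ≤ 1 →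
      μ.real {x | x + g ∈ B ∩ T} ≤ G * J + η * J₀ →
      (quasiPosterior prior n Ln).real S' ≤ G + ρ := by
    intro S' B hS' hB hSB G hG hGJ
    have hupB := hup B hB
    rw [← ofReal_measureReal] at hupB
    have h1 := quasiPosterior_le hΘo hε hrate2 hquad gaussianConst_ne_zero gaussianConst_ne_top
      ha hτ hτJ measureReal_nonneg hupB hlow hS' hSB
    refine le_trans (ENNReal.toReal_le_of_le_ofReal ?_ h1)
      (ratio_bound hεη hη hη1 hJ₀pos hJ hG measureReal_nonneg hGJ)
    have : 0 < J - η * J₀ := sub_pos.2 hτJ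
    positivity
  set G := condNormCDF T g z with hGdef
  have hGJ : G * J = μ.real ({x | x + g ∈ T} ∩ {x | ‖x‖ ^ 2 ≤ z}) := by
    rw [hGdef, condNormCDF_eq, div_mul_cancel₀ _ hJpos.ne']
  have hG0 : 0 ≤ G := measureReal_nonneg
  have hG1 : G ≤ 1 := by
    have : G * J ≤ J := hGJ.trans_le (measureReal_mono inter_subset_left)
    nlinarith
  rw [abs_le]
  constructor
  -- The lower bound, from the complement: off `S` the squared distance exceeds `z - 8ε`, and the
  -- shell between `z - 8ε` and `z` has small mass.
  · have h := hpost Sᶜ {x | z - 8 * ε < ‖g - x‖ ^ 2} hS.compl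
      (isOpen_lt (by fun_prop) (by fun_prop)).measurableSet ?_ (1 - G) (by linarith) ?_
    · rw [probReal_compl_eq_one_sub hS] at h
      change -ρ ≤ (quasiPosterior prior n Ln).real S - G
      linarith
    · rintro θ ⟨hθS, hθ⟩
      obtain ⟨y, hy, hyε⟩ := hqlr θ hθ
      rw [hSdef, mem_compl_iff, mem_ofPred_eq, hy, EReal.coe_le_coe_iff, not_le] at hθS
      rw [abs_le] at hyε
      rw [mem_ofPred_eq]
      linarith [hyε.2]
    · have hsub : {x | x + g ∈ {x | z - 8 * ε < ‖g - x‖ ^ 2} ∩ (T : Set _)} ⊆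
          ({x | x + g ∈ T} \ ({x | x + g ∈ T} ∩ {x | ‖x‖ ^ 2 ≤ z})) ∪
            {x | z - 8 * ε < ‖x‖ ^ 2 ∧ ‖x‖ ^ 2 ≤ z} := by
        rintro x ⟨hx1, hx2⟩
        rw [mem_ofPred_eq, norm_sub_rev, add_sub_cancel_right] at hx1
        by_cases hxz : ‖x‖ ^ 2 ≤ z
        · exact Or.inr ⟨hx1, hxz⟩
        · exact Or.inl ⟨hx2, fun h => hxz h.2⟩
      refine (measureReal_mono hsub).trans ((measureReal_union_le _ _).trans
        (add_le_add ?_ (hmod _ _ (by linarith))))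
      rw [measureReal_sdiff inter_subset_left
        (hTm.inter (isClosed_le (by fun_prop) (by fun_prop)).measurableSet), ← hGJ]
      linarith
  · have h := hpost S {x | ‖g - x‖ ^ 2 ≤ z + 8 * ε} hS
      (isClosed_le (by fun_prop) (by fun_prop)).measurableSet ?_ G hG1 ?_
    · change (quasiPosterior prior n Ln).real S - G ≤ ρ
      linarith
    · rintro θ ⟨hθS, hθ⟩
      obtain ⟨y, hy, hyε⟩ := hqlr θ hθ
      rw [hSdef, mem_ofPred_eq, hy, EReal.coe_le_coe_iff] at hθS
      rw [abs_le] at hyε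
      rw [mem_ofPred_eq]
      linarith [hyε.1]
    · have hsub : {x | x + g ∈ {x | ‖g - x‖ ^ 2 ≤ z + 8 * ε} ∩ (T : Set _)} ⊆
          ({x | x + g ∈ T} ∩ {x | ‖x‖ ^ 2 ≤ z}) ∪
            {x | z < ‖x‖ ^ 2 ∧ ‖x‖ ^ 2 ≤ z + 8 * ε} := by
        rintro x ⟨hx1, hx2⟩
        rw [mem_ofPred_eq, norm_sub_rev, add_sub_cancel_right] at hx1
        by_cases hxz : ‖x‖ ^ 2 ≤ z
        · exact Or.inl ⟨hx2, hxz⟩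
        · exact Or.inr ⟨not_le.1 hxz, hx1⟩
      refine (measureReal_mono hsub).trans ((measureReal_union_le _ _).trans
        (add_le_add hGJ.ge (hmod _ _ le_rfl)))

end PosteriorCDF

end QLRPosterior

namespace QLRPosterior

/-! ### Tightness and the stochastic limit -/

section Stochastic

variable {Ω : Type*} [MeasurableSpace Ω] {P : Measure Ω}

theorem LittleOP.mono {X Y : ℕ → Ω → ℝ≥0∞} (hX : LittleOP P X) (h : ∀ n ω, Y n ω ≤ X n ω) :
    LittleOP P Y := fun ε hε =>
  tendsto_of_tendsto_of_tendsto_of_le_of_le tendsto_const_nhds (hX ε hε) (fun _ => zero_le)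
    fun n => measure_mono fun ω hω => le_trans hω (h n ω)

/-- A sequence converging in distribution is bounded in probability. -/
theorem exists_eventually_measure_norm_le {d : ℕ} [IsProbabilityMeasure P]
    {V : ℕ → Ω → EuclideanSpace ℝ (Fin d)} {ν : Measure (EuclideanSpace ℝ (Fin d))}
    [IsProbabilityMeasure ν] (hV : TendstoInDistribution V atTop id (fun _ => P) ν)
    {ε : ℝ≥0∞} (hε : 0 < ε) :
    ∃ M : ℝ, ∀ᶠ n in atTop, P {ω | M ≤ ‖V n ω‖} ≤ ε := by
  have hcl : ∀ M : ℝ, IsClosed {x : EuclideanSpace ℝ (Fin d) | M ≤ ‖x‖} := fun M =>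
    isClosed_le continuous_const continuous_norm
  obtain ⟨K, hK⟩ : ∃ K : ℕ, ν {x | (K : ℝ) ≤ ‖x‖} < ε := by
    have h := tendsto_measure_iInter_atTop (μ := ν)
      (s := fun K : ℕ => {x : EuclideanSpace ℝ (Fin d) | (K : ℝ) ≤ ‖x‖})
      (fun K => (hcl K).measurableSet.nullMeasurableSet)
      (fun K L h x (hx : (L : ℝ) ≤ ‖x‖) => (Nat.cast_le.2 h).trans hx) ⟨0, measure_ne_top _ _⟩
    have hempty : (⋂ K : ℕ, {x : EuclideanSpace ℝ (Fin d) | (K : ℝ) ≤ ‖x‖}) = ∅ := by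
      refine eq_empty_of_forall_notMem fun x hx => ?_
      obtain ⟨K, hK⟩ := exists_nat_gt ‖x‖
      exact absurd (mem_iInter.1 hx K) (not_le.2 hK)
    rw [hempty, measure_empty] at h
    exact (h.eventually_lt_const hε).exists
  refine ⟨K, ?_⟩
  have h := ProbabilityMeasure.limsup_measure_closed_le_of_tendsto hV.tendsto (hcl K)
  simp only [ProbabilityMeasure.coe_mk, Measure.map_id] at h
  filter_upwards [eventually_lt_of_limsup_lt (h.trans_lt hK)] with n hn
  rw [Measure.map_apply_of_aemeasurable (hV.forall_aemeasurable n) (hcl K).measurableSet] at hn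
  exact hn.le

end Stochastic

/-- A point of `T` is at distance `0` from `T`, so covering brings it near the image of `A`. The
infimum need not be attained, hence `2ε`; nonemptiness is required because `Metric.infDist` to the
empty set is `0`. -/
theorem exists_norm_sub_sq_le {Θ : Type*} {d : ℕ} {A : Set Θ} (hA : A.Nonempty)
    {φ : Θ → EuclideanSpace ℝ (Fin d)} {T : Set (EuclideanSpace ℝ (Fin d))} {M ε : ℝ}
    (hε : 0 < ε)
    (h : ⨆ b ∈ Metric.closedBall (0 : EuclideanSpace ℝ (Fin d)) M,
      ‖Metric.infDist b (φ '' A) ^ 2 - Metric.infDist b T ^ 2‖ₑ < ENNReal.ofReal ε)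
    {g : EuclideanSpace ℝ (Fin d)} (hgT : g ∈ T) (hgM : ‖g‖ ≤ M) :
    ∃ θ ∈ A, ‖g - φ θ‖ ^ 2 ≤ 2 * ε := by
  have h1 : ‖Metric.infDist g (φ '' A) ^ 2 - Metric.infDist g T ^ 2‖ₑ < ENNReal.ofReal ε :=
    (le_iSup₂ (f := fun b (_ : b ∈ Metric.closedBall (0 : EuclideanSpace ℝ (Fin d)) M) =>
      ‖Metric.infDist b (φ '' A) ^ 2 - Metric.infDist b T ^ 2‖ₑ) g (by simpa using hgM)).trans_lt h
  rw [Metric.infDist_zero_of_mem hgT, zero_pow two_ne_zero, sub_zero, ← ofReal_norm,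
    ENNReal.ofReal_lt_ofReal_iff hε, Real.norm_of_nonneg (sq_nonneg _)] at h1
  have h2 : Metric.infDist g (φ '' A) < √(2 * ε) := Real.lt_sqrt_of_sq_lt (by linarith)
  obtain ⟨_, ⟨θ, hθ, rfl⟩, hlt⟩ := (Metric.infDist_lt_iff (hA.image φ)).1 h2
  refine ⟨θ, hθ, ?_⟩
  rw [dist_eq_norm] at hlt
  exact ((Real.lt_sqrt (norm_nonneg _)).1 hlt).le

theorem condNormCDF_of_eq_univ {d : ℕ} {T : ProperCone ℝ (EuclideanSpace ℝ (Fin d))}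
    (hT : (T : Set (EuclideanSpace ℝ (Fin d))) = univ) (v : EuclideanSpace ℝ (Fin d)) (z : ℝ) :
    condNormCDF T v z = chiSqCDF d z := by
  have h : {x | x + v ∈ T} = univ := by
    ext x
    simpa using hT.ge (mem_univ (x + v))
  rw [condNormCDF_eq, h, univ_inter, probReal_univ, div_one, chiSqCDF_eq]

theorem exists_error_lt {e : ℝ≥0∞} (he : 0 < e) : ∃ η : ℝ, 0 < η ∧ η < 1 ∧
    ENNReal.ofReal (η + Real.exp (2 * η) * (1 + 2 * η) / (1 - η) - 1) < e := by
  have h : Tendsto (fun η : ℝ => ENNReal.ofReal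
      (η + Real.exp (2 * η) * (1 + 2 * η) / (1 - η) - 1)) (𝓝[>] 0) (𝓝 0) := by
    have hc : ContinuousAt (fun η : ℝ =>
        η + Real.exp (2 * η) * (1 + 2 * η) / (1 - η) - 1) 0 :=
      (continuousAt_id.add (ContinuousAt.div (by fun_prop) (by fun_prop) (by norm_num))).sub
        continuousAt_const
    have := (ENNReal.continuous_ofReal.continuousAt.comp hc).tendsto
    simp only [Function.comp_def, mul_zero, Real.exp_zero, add_zero, sub_zero, div_one, one_mul,
      zero_add, sub_self, ENNReal.ofReal_zero] at this
    exact this.mono_left nhdsWithin_le_nhds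
  obtain ⟨η, h1, h2, h3⟩ := ((h.eventually_lt_const he).and
    (Ioo_mem_nhdsGT (one_pos (α := ℝ)))).exists
  exact ⟨η, h2, h3, h1⟩

end QLRPosterior

open QLRPosterior in
-- Off a union of bad events the deterministic bound applies for all `z` at once. Outer measure is
-- subadditive, so the supremum over `z` need not be measurable.
theorem littleOP_postCDF_sub_condNormCDF
    {Ω 𝒳 Θ : Type*} [MeasurableSpace Ω] [MeasurableSpace 𝒳] [MeasurableSpace Θ]
    (P : Measure Ω) [IsProbabilityMeasure P] (X : ℕ → Ω → 𝒳) (prior : Measure Θ)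
    (L : (n : ℕ) → (Fin n → 𝒳) → Θ → EReal) (hL : ∀ n, Measurable (Function.uncurry (L n)))
    (hLtop : ∀ n x θ, L n x θ ≠ ⊤) (θhat : (n : ℕ) → (Fin n → 𝒳) → Θ)
    (Θo : ℕ → Set Θ) (hΘo_meas : ∀ n, MeasurableSet (Θo n)) (hΘo_ne : ∀ n, (Θo n).Nonempty)
    (N : Set Θ) (hN_meas : MeasurableSet N) (hΘoN : ∀ᶠ n in atTop, Θo n ⊆ N)
    (d : ℕ) (hd : 1 ≤ d) (γ : Θ → EuclideanSpace ℝ (Fin d))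
    (hγ : AEMeasurable γ (prior.restrict N))
    (Γ : Set (EuclideanSpace ℝ (Fin d))) (hΓ_meas : MeasurableSet Γ)
    (hγΓ : ∀ θ ∈ N, γ θ ∈ Γ) (h0 : (0 : EuclideanSpace ℝ (Fin d)) ∈ Γ)
    (hsat : ∀ M : ℝ, ∀ᶠ n : ℕ in atTop, ∀ᵐ θ ∂prior,
      θ ∈ N → √(n : ℝ) * ‖γ θ‖ ≤ M → γ θ ∈ γ '' Θo n → θ ∈ Θo n)
    (T : ProperCone ℝ (EuclideanSpace ℝ (Fin d)))
    (hT_vol : 0 < volume (T : Set (EuclideanSpace ℝ (Fin d))))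
    (hcover : Covers (fun n : ℕ => (fun θ => √(n : ℝ) • γ θ) '' Θo n)
      (T : Set (EuclideanSpace ℝ (Fin d))))
    (hrate1 : LittleOP P fun n ω =>
      ((n : EReal) * (L n (sample X n ω) (θhat n (sample X n ω))
        - ⨆ θ ∈ Θo n, L n (sample X n ω) θ)).abs)
    (hrate2 : LittleOP P fun n ω => quasiPosterior prior n (L n (sample X n ω)) (Θo n)ᶜ)
    (ℓ : (n : ℕ) → (Fin n → 𝒳) → ℝ) (γhat : (n : ℕ) → (Fin n → 𝒳) → EuclideanSpace ℝ (Fin d))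
    (hquad : LittleOP P fun n ω =>
      ⨆ θ ∈ Θo n, ((n : EReal) * L n (sample X n ω) θ
        - ((ℓ n (sample X n ω) + 1 / 2 * ‖√(n : ℝ) • γhat n (sample X n ω)‖ ^ 2
            - 1 / 2 * ‖√(n : ℝ) • (γhat n (sample X n ω) - γ θ)‖ ^ 2 : ℝ) : EReal)).abs)
    (hγ_small : Tendsto (fun n => ⨆ θ ∈ Θo n, ‖γ θ‖ₑ) atTop (𝓝 0))
    (V : ℕ → Ω → EuclideanSpace ℝ (Fin d))
    (hproj : ∀ n : ℕ, 1 ≤ n → ∀ᵐ ω ∂P, √(n : ℝ) • γhat n (sample X n ω) = coneProj T (V n ω))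
    (ν : Measure (EuclideanSpace ℝ (Fin d))) [IsProbabilityMeasure ν]
    (hV : TendstoInDistribution V atTop id (fun _ => P) ν)
    (hprior1 : ∀ n ≥ 1, ∀ᵐ ω ∂P, ∫⁻ θ, EReal.exp (n * L n (sample X n ω) θ) ∂prior < ∞)
    (δ : ℝ) (hδ : 0 < δ) (dens : EuclideanSpace ℝ (Fin d) → ℝ)
    (hdens_cont : ContinuousOn dens (Metric.ball 0 δ ∩ Γ))
    (hdens_pos : ∀ g ∈ Metric.ball 0 δ ∩ Γ, 0 < dens g)
    (hdens : ((prior.restrict N).map γ).restrict (Metric.ball 0 δ ∩ Γ)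
      = (volume.restrict (Metric.ball 0 δ ∩ Γ)).withDensity fun g => ENNReal.ofReal (dens g)) :
    LittleOP P fun n ω => ⨆ z : ℝ,
      ‖postCDF prior n (L n (sample X n ω)) (θhat n (sample X n ω)) z
        - condNormCDF T (√(n : ℝ) • γhat n (sample X n ω)) z‖ₑ := by
  intro e he
  obtain ⟨η, hη, hη1, hηe⟩ := exists_error_lt he
  set J₀ := (stdGaussian (EuclideanSpace ℝ (Fin d))).real T with hJ₀
  have hJ₀pos : 0 < J₀ := ENNReal.toReal_pos
    (stdGaussian_pos T.isClosed.measurableSet hT_vol).ne' (measure_ne_top _ _)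
  have hτ : 0 < η * J₀ := by positivity
  obtain ⟨κ, hκ, hmod⟩ := exists_stdGaussian_norm_sq_Ioc_le hd hτ
  -- `8ε` is the error in the QLR statistic and must stay within the modulus `κ`.
  set ε := min η (κ / 8) with hεdef
  have hε : 0 < ε := lt_min hη (by positivity)
  have hεκ : 8 * ε ≤ κ := by linarith [min_le_right η (κ / 8)]
  have hεpos : 0 < ENNReal.ofReal ε := ENNReal.ofReal_pos.2 hε
  have hdens0 : 0 < dens 0 := hdens_pos 0 ⟨Metric.mem_ball_self hδ, h0⟩
  rw [ENNReal.tendsto_nhds_zero]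
  intro p hp
  -- Four bad events have small probability; the other two, on the projection identity and the
  -- finite normalizer, are null.
  have hp4 : 0 < p / 4 := ENNReal.div_pos hp.ne' (by simp)
  obtain ⟨M, hM⟩ := exists_eventually_measure_norm_le hV hp4
  filter_upwards [eventually_ge_atTop 1, hM, ENNReal.tendsto_nhds_zero.1 (hrate1 _ hεpos) _ hp4,
    ENNReal.tendsto_nhds_zero.1 (hrate2 _ hεpos) _ hp4,
    ENNReal.tendsto_nhds_zero.1 (hquad _ hεpos) _ hp4,
    eventually_local_gaussian hΘo_meas hN_meas hΘoN hγ hΓ_meas hγΓ hsat hcover hγ_small hδ h0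
      hdens_cont hdens_pos hdens M hτ,
    (hcover.1 M).eventually_lt_const hεpos] with n hn hMn h1 h2 h3 hloc hcov
  set b1 := {ω | M ≤ ‖V n ω‖}
  set b2 := {ω | ENNReal.ofReal ε ≤ ((n : EReal) * (L n (sample X n ω) (θhat n (sample X n ω))
        - ⨆ θ ∈ Θo n, L n (sample X n ω) θ)).abs}
  set b3 := {ω | ENNReal.ofReal ε ≤
    quasiPosterior prior n (L n (sample X n ω)) (Θo n)ᶜ}
  set b4 := {ω | ENNReal.ofReal ε ≤ ⨆ θ ∈ Θo n, ((n : EReal) * L n (sample X n ω) θ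
        - ((ℓ n (sample X n ω) + 1 / 2 * ‖√(n : ℝ) • γhat n (sample X n ω)‖ ^ 2
            - 1 / 2 * ‖√(n : ℝ) • (γhat n (sample X n ω) - γ θ)‖ ^ 2 : ℝ) : EReal)).abs}
  set b5 := {ω | ¬ √(n : ℝ) • γhat n (sample X n ω) = coneProj T (V n ω)}
  set b6 := {ω | ¬ ∫⁻ θ, EReal.exp (n * L n (sample X n ω) θ) ∂prior < ∞}
  have h5 : P b5 = 0 := hproj n hn
  have h6 : P b6 = 0 := hprior1 n hn
  have hsub : {ω | e ≤ ⨆ z : ℝ,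
      ‖postCDF prior n (L n (sample X n ω)) (θhat n (sample X n ω)) z
        - condNormCDF T (√(n : ℝ) • γhat n (sample X n ω)) z‖ₑ} ⊆
      ((((b1 ∪ b2) ∪ b3) ∪ b4) ∪ b5) ∪ b6 := by
    intro ω hω
    by_contra hbad
    simp only [mem_union, not_or] at hbad
    obtain ⟨⟨⟨⟨⟨g1, g2⟩, g3⟩, g4⟩, g5⟩, g6⟩ := hbad
    simp only [b1, b2, b3, b4, b5, b6, mem_ofPred_eq, not_le, not_not] at g1 g2 g3 g4 g5 g6
    set g := √(n : ℝ) • γhat n (sample X n ω) with hg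
    have hgT : g ∈ T := g5 ▸ coneProj_mem T _
    have hgM : ‖g‖ ≤ M := by
      rw [g5]
      exact (norm_coneProj_le T _).trans g1.le
    have hloc' := hloc g hgM
    refine absurd hω (not_le.2 (lt_of_le_of_lt (iSup_le fun z => ?_) hηe))
    rw [← ofReal_norm, Real.norm_eq_abs]
    refine ENNReal.ofReal_le_ofReal ?_
    refine abs_postCDF_sub_condNormCDF_le (Θo := Θo n) (φ := fun θ => √(n : ℝ) • γ θ)
      (c := ℓ n (sample X n ω) + 1 / 2 * ‖g‖ ^ 2) T hn (hL n).of_uncurry_left (hLtop _ _ _)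
      (hΘo_meas n) hgT hε.le (min_le_left _ _) hη hη1 g6 g2.le g3.le (fun θ hθ => ?_)
      (exists_norm_sub_sq_le (hΘo_ne n) hε hcov hgT hgM) (localScale_ne_zero hdens0 hn)
      localScale_ne_top hJ₀ hJ₀pos hloc'.1 hloc'.2
      (fun z z' hz => hmod z z' (by linarith)) z
    have h := (le_iSup₂ (f := fun θ (_ : θ ∈ Θo n) => ((n : EReal) * L n (sample X n ω) θ
      - ((ℓ n (sample X n ω) + 1 / 2 * ‖g‖ ^ 2
        - 1 / 2 * ‖√(n : ℝ) • (γhat n (sample X n ω) - γ θ)‖ ^ 2 : ℝ) : EReal)).abs)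
      θ hθ).trans g4.le
    rwa [smul_sub, ← hg] at h
  calc P _ ≤ P (((((b1 ∪ b2) ∪ b3) ∪ b4) ∪ b5) ∪ b6) := measure_mono hsub
    _ ≤ ((((P b1 + P b2) + P b3) + P b4) + P b5) + P b6 := by
        refine (measure_union_le _ _).trans (add_le_add_left ?_ _)
        refine (measure_union_le _ _).trans (add_le_add_left ?_ _)
        refine (measure_union_le _ _).trans (add_le_add_left ?_ _)
        refine (measure_union_le _ _).trans (add_le_add_left ?_ _)
        exact measure_union_le _ _
    _ ≤ ((((p / 4 + p / 4) + p / 4) + p / 4) + 0) + 0 := by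
        rw [h5, h6]
        gcongr
    _ = p := by
        rw [add_zero, add_zero]
        have : p / 4 + p / 4 + p / 4 + p / 4 = 4 * (p / 4) := by ring
        rw [this, ENNReal.mul_div_cancel (by simp) (by simp)]

theorem lemmal
    -- probability space, data, parameter space, prior
    {Ω 𝒳 Θ : Type*} [MeasurableSpace Ω] [MeasurableSpace 𝒳]
    [TopologicalSpace Θ] [MeasurableSpace Θ]
    (P : Measure Ω) [IsProbabilityMeasure P]
    (X : ℕ → Ω → 𝒳) (hX : ∀ i, Measurable (X i))
    (prior : Measure Θ) [SigmaFinite prior]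
    -- population objective function, with nonempty identified set
    (Lpop : Θ → ℝ) (hΘI : (QLRPosterior.identifiedSet Lpop).Nonempty)
    -- sample criterion, with values in `[-∞, ∞)`, and the estimator
    (L : (n : ℕ) → (Fin n → 𝒳) → Θ → EReal)
    (hL : ∀ n, Measurable (Function.uncurry (L n)))
    (hLtop : ∀ n x θ, L n x θ ≠ ⊤)
    (θhat : (n : ℕ) → (Fin n → 𝒳) → Θ)
    -- local neighborhoods of the identified set, inside a fixed neighborhood `N`
    (Θo : ℕ → Set Θ) (hΘo_meas : ∀ n, MeasurableSet (Θo n))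
    (hΘo_nhds : ∀ n, Θo n ∈ 𝓝ˢ (QLRPosterior.identifiedSet Lpop))
    (N : Set Θ) (hN_meas : MeasurableSet N)
    (hN_nhds : N ∈ 𝓝ˢ (QLRPosterior.identifiedSet Lpop))
    (hΘoN : ∀ᶠ n in atTop, Θo n ⊆ N)
    -- local reduced-form reparameterization (only its values on `N` matter)
    (d : ℕ) (hd : 1 ≤ d) (γ : Θ → EuclideanSpace ℝ (Fin d)) (hγ_meas : Measurable (N.domRestrict γ))
    (Γ : Set (EuclideanSpace ℝ (Fin d))) (hΓ_meas : MeasurableSet Γ)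
    (hγΓ : ∀ θ ∈ N, γ θ ∈ Γ)
    (hγ_zero : ∀ θ ∈ N, γ θ = 0 ↔ θ ∈ QLRPosterior.identifiedSet Lpop)
    -- the local neighborhoods are described by the reduced form at the scale `n ^ (-1/2)`
    (hsat : ∀ M : ℝ, ∀ᶠ n : ℕ in atTop, ∀ᵐ θ ∂prior,
      θ ∈ N → √(n : ℝ) * ‖γ θ‖ ≤ M → γ θ ∈ γ '' Θo n → θ ∈ Θo n)
    -- the local parameter spaces cover a closed convex cone of positive volume
    (T : ProperCone ℝ (EuclideanSpace ℝ (Fin d)))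
    (hT_vol : 0 < volume (T : Set (EuclideanSpace ℝ (Fin d))))
    (hcover : QLRPosterior.Covers (fun n : ℕ => (fun θ => √(n : ℝ) • γ θ) '' Θo n)
      (T : Set (EuclideanSpace ℝ (Fin d))))
    -- posterior contraction
    (hrate1 : QLRPosterior.LittleOP P fun n ω =>
      ((n : EReal) * (L n (QLRPosterior.sample X n ω) (θhat n (QLRPosterior.sample X n ω))
        - ⨆ θ ∈ Θo n, L n (QLRPosterior.sample X n ω) θ)).abs)
    (hrate2 : QLRPosterior.LittleOP P fun n ω =>
      QLRPosterior.quasiPosterior prior n (L n (QLRPosterior.sample X n ω)) (Θo n)ᶜ)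
    -- local quadratic approximation
    (ℓ : (n : ℕ) → (Fin n → 𝒳) → ℝ) (hℓ : ∀ n, Measurable (ℓ n))
    (γhat : (n : ℕ) → (Fin n → 𝒳) → EuclideanSpace ℝ (Fin d)) (hγhat : ∀ n, Measurable (γhat n))
    (hquad : QLRPosterior.LittleOP P fun n ω =>
      ⨆ θ ∈ Θo n, ((n : EReal) * L n (QLRPosterior.sample X n ω) θ
        - ((ℓ n (QLRPosterior.sample X n ω)
            + 1 / 2 * ‖√(n : ℝ) • γhat n (QLRPosterior.sample X n ω)‖ ^ 2
            - 1 / 2 * ‖√(n : ℝ) • (γhat n (QLRPosterior.sample X n ω) - γ θ)‖ ^ 2 : ℝ)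
              : EReal)).abs)
    (hγ_small : Tendsto (fun n => ⨆ θ ∈ Θo n, ‖γ θ‖ₑ) atTop (𝓝 0))
    (V : ℕ → Ω → EuclideanSpace ℝ (Fin d))
    (hproj : ∀ n : ℕ, 1 ≤ n → ∀ᵐ ω ∂P,
      √(n : ℝ) • γhat n (QLRPosterior.sample X n ω) = QLRPosterior.coneProj T (V n ω))
    (S : Matrix (Fin d) (Fin d) ℝ) (hS : S.PosSemidef)
    (hV : TendstoInDistribution V atTop id (fun _ => P) (multivariateGaussian 0 S))
    -- prior condition
    (hprior1 : ∀ n ≥ 1, ∀ᵐ ω ∂P,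
      ∫⁻ θ, EReal.exp (n * L n (QLRPosterior.sample X n ω) θ) ∂prior < ∞)
    (δ : ℝ) (hδ : 0 < δ) (dens : EuclideanSpace ℝ (Fin d) → ℝ)
    (hdens_cont : ContinuousOn dens (Metric.ball 0 δ ∩ Γ))
    (hdens_pos : ∀ g ∈ Metric.ball 0 δ ∩ Γ, 0 < dens g)
    (hdens : ((prior.restrict N).map γ).restrict (Metric.ball 0 δ ∩ Γ)
      = (volume.restrict (Metric.ball 0 δ ∩ Γ)).withDensity fun g => ENNReal.ofReal (dens g)) :
    (QLRPosterior.LittleOP P fun n ω => ⨆ z : ℝ,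
      ‖QLRPosterior.postCDF prior n (L n (QLRPosterior.sample X n ω))
          (θhat n (QLRPosterior.sample X n ω)) z
        - QLRPosterior.condNormCDF T (√(n : ℝ) • γhat n (QLRPosterior.sample X n ω)) z‖ₑ) ∧
    ((T : Set (EuclideanSpace ℝ (Fin d))) ≠ univ →
      QLRPosterior.LittleOP P fun n ω => ⨆ z : ℝ, ENNReal.ofReal
        (QLRPosterior.postCDF prior n (L n (QLRPosterior.sample X n ω))
            (θhat n (QLRPosterior.sample X n ω)) z
          - QLRPosterior.coneCDF T z)) ∧
    ((T : Set (EuclideanSpace ℝ (Fin d))) = univ →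
      QLRPosterior.LittleOP P fun n ω => ⨆ z : ℝ,
        ‖QLRPosterior.postCDF prior n (L n (QLRPosterior.sample X n ω))
            (θhat n (QLRPosterior.sample X n ω)) z
          - QLRPosterior.chiSqCDF d z‖ₑ) := by
  have hΘo_ne : ∀ n, (Θo n).Nonempty := fun n =>
    hΘI.mono (subset_of_mem_nhdsSet (hΘo_nhds n))
  have h0 : (0 : EuclideanSpace ℝ (Fin d)) ∈ Γ := by
    obtain ⟨θ, hθ⟩ := hΘI
    have hθN := subset_of_mem_nhdsSet hN_nhds hθ
    rw [← (hγ_zero θ hθN).2 hθ]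
    exact hγΓ θ hθN
  have hmain := littleOP_postCDF_sub_condNormCDF P X prior L hL hLtop θhat Θo hΘo_meas hΘo_ne N
    hN_meas hΘoN d hd γ (aemeasurable_restrict_of_measurable_subtype hN_meas hγ_meas) Γ hΓ_meas
    hγΓ h0 hsat T hT_vol hcover hrate1 hrate2 ℓ γhat hquad hγ_small V hproj _ hV hprior1 δ hδ dens
    hdens_cont hdens_pos hdens
  refine ⟨hmain, fun _ => hmain.mono fun n ω => iSup_mono fun z => ?_, fun hT =>
    hmain.mono fun n ω => iSup_mono fun z => ?_⟩
  -- As `F_T` dominates the conditional distribution function, the excess over `F_T` is at most the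
  -- error already controlled.
  · rw [← ofReal_norm, Real.norm_eq_abs]
    refine ENNReal.ofReal_le_ofReal (le_trans ?_ (le_abs_self _))
    exact sub_le_sub_left (QLRPosterior.condNormCDF_le_coneCDF T _ z) _
  · rw [QLRPosterior.condNormCDF_of_eq_univ hT]
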